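/- For real $x>1$ and $\nu,\mu\in\mathbb C$ let $$P_\nu^\mu(x)=\Big(\frac{x+1}{x-1}\Big)^{\mu/2}\frac{1}{\Gamma(1-\mu)}\,{}_2F_1\Big(-\nu,\nu+1;1-\mu;\frac{1-x}{2}\Big),$$ and, for $\nu+\mu\notin\{-1,-2,\dots\}$, $$Q_\nu^\mu(x)=\frac{\sqrt\pi\,e^{i\pi\mu}\,\Gamma(\nu+\mu+1)\,(x^2-1)^{\mu/2}}{2^{\nu+1}\,x^{\nu+\mu+1}}\cdot\frac{1}{\Gamma(\nu+\frac32)}\,{}_2F_1\Big(\frac{\nu+\mu+1}{2},\frac{\nu+\mu+2}{2};\nu+\frac32;\frac1{x^2}\Big)$$ be the associated Legendre functions of the first and second kind. Here $\frac1{\Gamma(c)}\,{}_2F_1(a,b;c;z)$ denotes $\sum_{n\ge0}\frac{(a)_n(b)_n}{\Gamma(c+n)}\frac{z^n}{n!}$ for $|z|<1$ (with $1/\Gamma=0$ at the poles of $\Gamma$), and elsewhere on $\mathbb C\setminus[1,\infty)$ its analytic continuation; powers of positive numbers have their principal values. Let $$C_n^\mu(x)=\frac{(2\mu)_n}{n!}\,{}_2F_1\Big(-n,2\mu+n;\mu+\tfrac12;\frac{1-x}{2}\Big)$$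 be the Gegenbauer polynomials. **Theorem.** Let $\mu\in\mathbb C$ with $\operatorname{Re}\mu>-\frac12$ and $\mu\ne0$, let $\nu\in\mathbb C\setminus\{-1,-2,-3,\dots\}$, let $r,r'\in(0,\infty)$ with $r\neq r'$, and let $\gamma\in\mathbb R$. Put $r_<=\min\{r,r'\}$, $r_>=\max\{r,r'\}$, and let $\rho\ge0$ be given by $$\cosh\rho=\cosh r\cosh r'-\sinh r\sinh r'\cos\gamma .$$ Then $$\frac{P_\nu^\mu(\cosh\rho)}{\sinh^\mu\rho}=\frac{2^\mu\Gamma(\mu)}{(\sinh r\sinh r')^\mu}\sum_{n=0}^\infty(-1)^n(n+\mu)\,P_\nu^{-(\mu+n)}(\cosh r_<)\,P_\nu^{\mu+n}(\cosh r_>)\,C_n^\mu(\cos\gamma),$$ and, if in addition $\nu+\mu\notin\{-1,-2,-3,\dots\}$ (so that the functions $Q_\nu^{\mu+n}$, $n\ge0$, are defined), $$\frac{Q_\nu^\mu(\cosh\rho)}{\sinh^\mu\rho}=\frac{2^\mu\Gamma(\mu)}{(\sinh r\sinh r')^\mu}\sum_{n=0}^\infty(-1)^n(n+\mu)\,P_\nu^{-(\mu+n)}(\cosh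 r_<)\,Q_\nu^{\mu+n}(\cosh r_>)\,C_n^\mu(\cos\gamma),$$ both series being absolutely convergent. -/

import Mathlib

open scoped Topology

/-- The Gauss series of the regularized hypergeometric function `₂F₁(a, b; c; z) / Γ(c)`, that is
`∑ (a)ₙ (b)ₙ / Γ(c + n) * zⁿ / n!`. Mathlib's `Complex.Gamma` vanishes at the poles of the gamma
function, so that `(Γ(c + n))⁻¹` is the entire function `1 / Γ` evaluated at `c + n`. -/
noncomputable def regHypSeries (a b c z : ℂ) : ℂ :=
  ∑' n : ℕ, (ascPochhammer ℂ n).eval a * (ascPochhammer ℂ n).eval b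
    * (Complex.Gamma (c + n))⁻¹ * z ^ n / (n.factorial : ℂ)

/-- `w` is the value at `z` of the analytic continuation of the Gauss series from a neighbourhood
of `0`, to an open set containing `z` that is star-shaped about `0`. -/
def IsHypContinuation (a b c z w : ℂ) : Prop :=
  ∃ (U : Set ℂ) (f : ℂ → ℂ), IsOpen U ∧ StarConvex ℝ 0 U ∧ z ∈ U ∧ DifferentiableOn ℂ f U ∧
    (∀ᶠ s in 𝓝 (0 : ℂ), f s = regHypSeries a b c s) ∧ f z = w

/-- The value of the analytic continuation is unique. -/
theorem IsHypContinuation.unique {a b c z w₁ w₂ : ℂ} (h₁ : IsHypContinuation a b c z w₁)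
    (h₂ : IsHypContinuation a b c z w₂) : w₁ = w₂ := by
  obtain ⟨U, f, hU, sU, zU, dU, eU, rfl⟩ := h₁
  obtain ⟨V, g, hV, sV, zV, dV, eV, rfl⟩ := h₂
  have hs : StarConvex ℝ 0 (U ∩ V) := sU.inter sV
  have h0 : (0 : ℂ) ∈ U ∩ V := hs.mem ⟨z, zU, zV⟩
  have hc : IsPreconnected (U ∩ V) := (hs.isPathConnected h0).isConnected.isPreconnected
  have hf : AnalyticOnNhd ℂ f (U ∩ V) :=
    (dU.mono Set.inter_subset_left).analyticOnNhd (hU.inter hV)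
  have hg : AnalyticOnNhd ℂ g (U ∩ V) :=
    (dV.mono Set.inter_subset_right).analyticOnNhd (hU.inter hV)
  refine hf.eqOn_of_preconnected_of_eventuallyEq hg hc h0 ?_ ⟨zU, zV⟩
  filter_upwards [eU, eV] with s h₁ h₂
  rw [h₁, h₂]

open Classical in
/-- The regularized Gauss hypergeometric function `₂F₁(a, b; c; z) / Γ(c)`: the Gauss series for
`|z| < 1`, and elsewhere its analytic continuation. -/
noncomputable def regHyp (a b c z : ℂ) : ℂ :=
  if ‖z‖ < 1 then regHypSeries a b c z
  else if h : ∃ w, IsHypContinuation a b c z w then h.choose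
  else 0

/-- The associated Legendre function of the first kind `P_ν^μ(x)`, for real `x > 1`. -/
noncomputable def legendreP (ν μ : ℂ) (x : ℝ) : ℂ :=
  (((x + 1) / (x - 1) : ℝ) : ℂ) ^ (μ / 2) *
    regHyp (-ν) (ν + 1) (1 - μ) (((1 - x) / 2 : ℝ) : ℂ)

/-- The associated Legendre function of the second kind `Q_ν^μ(x)`, for real `x > 1` and
`ν + μ ∉ {-1, -2, …}`. -/
noncomputable def legendreQ (ν μ : ℂ) (x : ℝ) : ℂ :=
  (Real.sqrt Real.pi : ℂ) * Complex.exp (Complex.I * Real.pi * μ) * Complex.Gamma (ν + μ + 1) *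
      ((x ^ 2 - 1 : ℝ) : ℂ) ^ (μ / 2) / ((2 : ℂ) ^ (ν + 1) * (x : ℂ) ^ (ν + μ + 1)) *
    regHyp ((ν + μ + 1) / 2) ((ν + μ + 2) / 2) (ν + 3 / 2) ((1 / x ^ 2 : ℝ) : ℂ)

/-- The Gegenbauer polynomial `C_n^μ(x)` for `μ + 1/2 ∉ {0, -1, -2, …}`; the hypergeometric series
terminates. -/
noncomputable def gegenbauerC (n : ℕ) (μ x : ℂ) : ℂ :=
  (ascPochhammer ℂ n).eval (2 * μ) / (n.factorial : ℂ) *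
    ordinaryHypergeometric (-(n : ℂ)) (2 * μ + n) (μ + 1 / 2) ((1 - x) / 2)

/-!
A family `F n`, `n ≥ 0`, with `F n' = F (n + 1)` that satisfies the three-term recurrence coming
from the Legendre equation is given both by `F n z = (z ^ 2 - 1) ^ (-(μ + n) / 2) * P_ν^(μ + n) (z)`
and by its analogue of the second kind, so both addition theorems are instances of one expansion of
`F 0`. With `c = cosh r_>` and `s = sinh r_>`, expand `F 0 (c + c * X - s * y)` about `X = y = 0`,
where `X = cosh r_< - 1` and `y = sinh r_< * cos γ`. This double power series and the right-hand
side, a sum of products of hypergeometric radial factors and homogeneous Gegenbauer polynomials in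
`y` and `X ^ 2 + 2 * X`, obey the same recurrence, which determines a double power series from its
restriction to `X = 0`; there the `n`-th summand is a multiple of `y ^ n`, and the two series agree.

The resulting identity of germs is carried to all `r_< < r_>` by the identity theorem in the
variable `u = tanh (r_< / 2)`: by Cauchy estimates `F n c` is `O(n! / D ^ n)` for every
`D < c - 1`, so the series converges locally uniformly for complex `u` with `s * |u| < c - 1`, and
`s * tanh (r_> / 2) = c - 1`. For real such `u` the argument of `F 0` stays in `(1, ∞)`.
-/

open Filter
open Complex (Gamma)
open Finset (range)
open Finset.HasAntidiagonal (antidiagonal sigmaAntidiagonalEquivProd)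

/-! ### Rising factorials and the regularized Gauss series -/

/-- The rising factorial `(a)ₙ`. -/
noncomputable abbrev poch (a : ℂ) (n : ℕ) : ℂ := (ascPochhammer ℂ n).eval a

theorem poch_zero (a : ℂ) : poch a 0 = 1 := by simp [poch]

theorem poch_succ (a : ℂ) (n : ℕ) : poch a (n + 1) = poch a n * (a + n) :=
  ascPochhammer_succ_eval n a

theorem poch_succ_left (a : ℂ) (n : ℕ) : poch a (n + 1) = a * poch (a + 1) n := by
  simp [poch, ascPochhammer_succ_left, Polynomial.eval_comp]

theorem mul_poch_add_one (a : ℂ) (n : ℕ) : a * poch (a + 1) n = poch a n * (a + n) := by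
  rw [← poch_succ, poch_succ_left]

theorem poch_add (a : ℂ) (m n : ℕ) : poch a (m + n) = poch a m * poch (a + m) n := by
  simp [poch, ← ascPochhammer_mul, Polynomial.eval_comp]

theorem poch_one (n : ℕ) : poch 1 n = n.factorial :=
  ascPochhammer_eval_one ℂ n

theorem poch_ne_zero {a : ℂ} (ha : ∀ k : ℕ, a + k ≠ 0) (n : ℕ) : poch a n ≠ 0 := by
  induction n with
  | zero => simp [poch_zero]
  | succ n ih => exact poch_succ a n ▸ mul_ne_zero ih (ha n)

theorem factorial_ne_zero (n : ℕ) : (n.factorial : ℂ) ≠ 0 := mod_cast n.factorial_ne_zero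

theorem factorial_succ (n : ℕ) : ((n + 1).factorial : ℂ) = (n + 1) * n.factorial := by
  push_cast [Nat.factorial_succ]
  rfl

theorem choose_mul_factorial_mul_factorial (k m : ℕ) :
    ((k + m).choose k : ℂ) * k.factorial * m.factorial = (k + m).factorial := by
  exact_mod_cast (Nat.choose_symm_add (a := k) (b := m)) ▸
    Nat.add_choose_mul_factorial_mul_factorial k m

theorem inv_Gamma_eq_mul (s : ℂ) : (Gamma s)⁻¹ = s * (Gamma (s + 1))⁻¹ :=
  Complex.one_div_Gamma_eq_self_mul_one_div_Gamma_add_one s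

theorem poch_mul_inv_Gamma (s : ℂ) (n : ℕ) :
    poch s n * (Gamma (s + n))⁻¹ = (Gamma s)⁻¹ := by
  induction n with
  | zero => simp [poch_zero]
  | succ n ih =>
    rw [← ih, poch_succ, inv_Gamma_eq_mul (s + n)]
    push_cast
    ring_nf

/-- The coefficients of the regularized Gauss series. -/
noncomputable def hypCoeff (a b c : ℂ) (n : ℕ) : ℂ :=
  poch a n * poch b n * (Gamma (c + n))⁻¹ / n.factorial

theorem hypCoeff_one (a c : ℂ) (n : ℕ) :
    hypCoeff a 1 c n = poch a n * (Gamma (c + n))⁻¹ := by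
  rw [hypCoeff, poch_one, mul_right_comm, mul_div_assoc, div_self (factorial_ne_zero n), mul_one]

theorem hypCoeff_one_one (a : ℂ) (n : ℕ) : hypCoeff a 1 1 n = poch a n / n.factorial := by
  rw [hypCoeff_one, add_comm, Complex.Gamma_nat_eq_factorial, div_eq_mul_inv]

theorem hypCoeff_succ (a b c : ℂ) (n : ℕ) :
    (c + n) * (n + 1) * hypCoeff a b c (n + 1) = (a + n) * (b + n) * hypCoeff a b c n := by
  have hfac := factorial_ne_zero n
  have hsucc : (n + 1 : ℂ) ≠ 0 := n.cast_add_one_ne_zero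
  rw [hypCoeff, hypCoeff, inv_Gamma_eq_mul (c + n), poch_succ, poch_succ, factorial_succ]
  push_cast
  rw [← add_assoc]
  field_simp

theorem coeff_regularizedGaussHGFunSeries (a b c : ℂ) (n : ℕ) :
    (Complex.regularizedGaussHGFunSeries a b c).coeff n = hypCoeff a b c n := by
  rw [Complex.coeff_regularizedGaussHGFunSeries, hypCoeff, mul_comm (n.factorial : ℂ),
    ← div_div, div_eq_mul_inv _ (Gamma _)]

theorem regHypSeries_eq_tsum (a b c z : ℂ) :
    regHypSeries a b c z = ∑' n : ℕ, hypCoeff a b c n * z ^ n :=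
  tsum_congr fun n => by rw [hypCoeff]; ring

theorem regHypSeries_symm (a b c z : ℂ) : regHypSeries a b c z = regHypSeries b a c z :=
  tsum_congr fun n => by rw [mul_comm ((ascPochhammer ℂ n).eval a)]

theorem hasFPowerSeriesOnBall_regHypSeries (a b c : ℂ) :
    HasFPowerSeriesOnBall (regHypSeries a b c) (Complex.regularizedGaussHGFunSeries a b c) 0 1 := by
  have hradius := Complex.radius_regularizedGaussHGFunSeries_ge_one a b c
  have hsum : regHypSeries a b c = (Complex.regularizedGaussHGFunSeries a b c).sum := by
    funext z
    simp only [regHypSeries_eq_tsum, FormalMultilinearSeries.sum,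
      FormalMultilinearSeries.apply_eq_pow_smul_coeff, coeff_regularizedGaussHGFunSeries,
      smul_eq_mul, mul_comm]
  exact hsum ▸ (FormalMultilinearSeries.hasFPowerSeriesOnBall _
    (one_pos.trans_le hradius)).mono one_pos hradius

theorem norm_sq_lt_one {w : ℂ} (hw : ‖w‖ < 1) : ‖w ^ 2‖ < 1 :=
  norm_pow w 2 ▸ pow_lt_one₀ (norm_nonneg w) hw two_ne_zero

theorem mem_eball_zero_one {z : ℂ} (hz : ‖z‖ < 1) : z ∈ Metric.eball (0 : ℂ) 1 := by
  simpa [enorm_eq_nnnorm, ← NNReal.coe_lt_coe] using hz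

theorem summable_norm_hypCoeff (a b c : ℂ) {z : ℂ} (hz : ‖z‖ < 1) :
    Summable fun n : ℕ => ‖hypCoeff a b c n * z ^ n‖ := by
  have hradius := Complex.radius_regularizedGaussHGFunSeries_ge_one a b c
  simpa [FormalMultilinearSeries.apply_eq_pow_smul_coeff, coeff_regularizedGaussHGFunSeries,
    mul_comm] using FormalMultilinearSeries.summable_norm_apply _
      (Metric.eball_subset_eball hradius (mem_eball_zero_one hz))

theorem hasSum_regHypSeries (a b c : ℂ) {z : ℂ} (hz : ‖z‖ < 1) :
    HasSum (fun n : ℕ => hypCoeff a b c n * z ^ n) (regHypSeries a b c z) := by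
  rw [regHypSeries_eq_tsum]
  exact (summable_norm_hypCoeff a b c hz).of_norm.hasSum

theorem exists_norm_le_of_summable_norm {f : ℕ → ℂ} (h : Summable fun n => ‖f n‖) :
    ∃ C : ℝ, 0 ≤ C ∧ ∀ n, ‖f n‖ ≤ C :=
  ⟨∑' n, ‖f n‖, tsum_nonneg fun _ => norm_nonneg _, fun n => h.le_tsum n fun _ _ => norm_nonneg _⟩

theorem exists_norm_hypCoeff_mul_pow_le (a b c : ℂ) {q : ℝ} (hq₀ : 0 ≤ q) (hq₁ : q < 1) :
    ∃ C : ℝ, 0 ≤ C ∧ ∀ n, ‖hypCoeff a b c n‖ * q ^ n ≤ C := by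
  have hnorm : ‖(q : ℂ)‖ = q := by rw [Complex.norm_real, Real.norm_of_nonneg hq₀]
  simpa only [norm_mul, norm_pow, hnorm] using
    exists_norm_le_of_summable_norm (summable_norm_hypCoeff a b c (hnorm.trans_lt hq₁))

theorem exists_norm_hypCoeff_le (a b c : ℂ) :
    ∃ C : ℝ, 0 ≤ C ∧ ∀ n, ‖hypCoeff a b c n‖ ≤ C * 2 ^ n := by
  obtain ⟨C, hC, hbound⟩ :=
    exists_norm_hypCoeff_mul_pow_le a b c (q := 1 / 2) (by norm_num) (by norm_num)
  refine ⟨C, hC, fun n => ?_⟩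
  simpa [← div_eq_mul_inv, div_le_iff₀] using hbound n

theorem differentiableOn_regHypSeries (a b c : ℂ) :
    DifferentiableOn ℂ (regHypSeries a b c) (Metric.ball 0 1) := by
  have h := (hasFPowerSeriesOnBall_regHypSeries a b c).differentiableOn
  rwa [← ENNReal.coe_one, Metric.eball_coe] at h

theorem hasSum_mul_deriv_regHypSeries (a b c : ℂ) {z : ℂ} (hz : ‖z‖ < 1) :
    HasSum (fun n : ℕ => n * hypCoeff a b c n * z ^ n) (z * deriv (regHypSeries a b c) z) := by
  have h := (hasFPowerSeriesOnBall_regHypSeries a b c).fderiv.hasSum (mem_eball_zero_one hz)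
  rw [zero_add] at h
  have hderiv : HasSum (fun n : ℕ => (n + 1) * hypCoeff a b c (n + 1) * z ^ n)
      (deriv (regHypSeries a b c) z) := by
    refine (h.mapL (ContinuousLinearMap.apply ℂ ℂ (1 : ℂ))).congr_fun fun n => ?_
    have hcoeff := FormalMultilinearSeries.derivSeries_coeff_one
      (Complex.regularizedGaussHGFunSeries a b c) n
    rw [coeff_regularizedGaussHGFunSeries, nsmul_eq_mul, Nat.cast_add_one] at hcoeff
    rw [FormalMultilinearSeries.apply_eq_pow_smul_coeff, ContinuousLinearMap.apply_apply,
      smul_apply, hcoeff, smul_eq_mul, mul_comm]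
  rw [← hasSum_nat_add_iff' 1]
  simpa [pow_succ, mul_comm, mul_left_comm, mul_assoc] using hderiv.mul_left z

/-! ### Pfaff's transformation -/

/-- The Chu–Vandermonde identity, in regularized form. -/
theorem sum_neg_one_pow_mul_choose_mul_poch (c d : ℂ) (N : ℕ) :
    ∑ k ∈ range (N + 1), (N.choose k : ℂ) * ((-1) ^ k * (poch d k * (Gamma (c + k))⁻¹)) =
      poch (c - d) N * (Gamma (c + N))⁻¹ := by
  induction N generalizing c with
  | zero => simp [poch_zero]
  | succ N ih =>
    have hdiff (k : ℕ) : poch d k * (Gamma (c + k))⁻¹ - poch d (k + 1) * (Gamma (c + (k + 1)))⁻¹ =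
        (c - d) * (poch d k * (Gamma (c + 1 + k))⁻¹) := by
      rw [inv_Gamma_eq_mul (c + k), poch_succ, add_right_comm c 1, add_assoc c]
      ring
    have hpascal := Finset.sum_choose_succ_mul
      (fun k _ => (-1 : ℂ) ^ k * (poch d k * (Gamma (c + k))⁻¹)) N
    rw [hpascal, ← Finset.sum_add_distrib, poch_succ_left, sub_add_eq_add_sub, mul_assoc,
      Nat.cast_add_one, add_comm (N : ℂ), ← add_assoc, ← ih (c + 1), Finset.mul_sum]
    refine Finset.sum_congr rfl fun k _ => ?_
    push_cast
    linear_combination (N.choose k : ℂ) * (-1) ^ k * hdiff k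

theorem hasSum_poch_div_factorial (s : ℂ) {w : ℂ} (hw : ‖w‖ < 1) :
    HasSum (fun m : ℕ => poch s m / m.factorial * w ^ m) ((1 - w) ^ (-s)) := by
  have h := (Complex.one_div_one_sub_cpow_hasFPowerSeriesOnBall_zero s).hasSum
    (mem_eball_zero_one hw)
  simp only [zero_add, one_div, ← Complex.cpow_neg] at h
  refine h.congr_fun fun m => ?_
  have hchoose : (m.factorial : ℂ) * Ring.choose (s + m - 1) m = poch s m := by
    have hdesc := Ring.descPochhammer_eq_factorial_smul_choose (s + m - 1 : ℂ) m
    rw [Polynomial.descPochhammer_smeval_eq_ascPochhammer,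
      Polynomial.ascPochhammer_smeval_cast, Polynomial.ascPochhammer_smeval_eq_eval,
      show s + m - 1 - m + 1 = s by ring] at hdesc
    rw [poch, hdesc, nsmul_eq_mul]
  rw [← hchoose, mul_div_cancel_left₀ _ (factorial_ne_zero m)]
  simp [FormalMultilinearSeries.ofScalars]

/-- The terms of the double series that reads as the Gauss series at `w` when summed along
antidiagonals, and as Pfaff's transform of it when summed along rows. -/
noncomputable def pfaffTerm (a d c w : ℂ) (p : ℕ × ℕ) : ℂ :=
  poch a (p.1 + p.2) * w ^ (p.1 + p.2) * ((-1) ^ p.1 * (poch d p.1 * (Gamma (c + p.1))⁻¹)) /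
    (p.1.factorial * p.2.factorial)

theorem pfaffTerm_eq (a d c w : ℂ) (k m : ℕ) :
    pfaffTerm a d c w (k, m) = hypCoeff a 1 1 (k + m) * w ^ (k + m) *
      ((k + m).choose k * ((-1) ^ k * hypCoeff d 1 c k)) := by
  have hk := factorial_ne_zero k
  have hm := factorial_ne_zero m
  have hchoose : ((k + m).choose k : ℂ) ≠ 0 :=
    mod_cast (Nat.choose_pos (Nat.le_add_right k m)).ne'
  rw [pfaffTerm, hypCoeff_one_one, hypCoeff_one, ← choose_mul_factorial_mul_factorial]
  field_simp

theorem summable_pfaffTerm (a d c : ℂ) {w : ℂ} (hw : ‖w‖ < 1 / 8) :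
    Summable (pfaffTerm a d c w) := by
  obtain ⟨C, hC, hCa⟩ := exists_norm_hypCoeff_le a 1 1
  obtain ⟨D, hD, hDd⟩ := exists_norm_hypCoeff_le d 1 c
  have hgeom : Summable fun p : ℕ × ℕ => (C * D) * ((8 * ‖w‖) ^ p.1 * (4 * ‖w‖) ^ p.2) :=
    ((summable_geometric_of_lt_one (by positivity) (by linarith)).mul_of_nonneg
      (summable_geometric_of_lt_one (by positivity) (by linarith))
      (fun _ => by positivity) (fun _ => by positivity)).mul_left _
  refine Summable.of_norm_bounded hgeom fun ⟨k, m⟩ => ?_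
  have hchoose : (((k + m).choose k : ℕ) : ℝ) ≤ 2 ^ (k + m) :=
    mod_cast Nat.choose_le_two_pow (k + m) k
  rw [pfaffTerm_eq]
  simp only [norm_mul, norm_pow, norm_neg, norm_one, one_pow, one_mul, Complex.norm_natCast]
  calc ‖hypCoeff a 1 1 (k + m)‖ * ‖w‖ ^ (k + m) * ((k + m).choose k * ‖hypCoeff d 1 c k‖)
      ≤ (C * 2 ^ (k + m)) * ‖w‖ ^ (k + m) * (2 ^ (k + m) * (D * 2 ^ k)) := by
        gcongr
        exacts [hCa _, hDd _]
    _ = C * D * ((8 * ‖w‖) ^ k * (4 * ‖w‖) ^ m) := by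
      rw [show (8 : ℝ) = 2 * 2 * 2 by norm_num, show (4 : ℝ) = 2 * 2 by norm_num]
      simp only [mul_pow, pow_add]
      ring

theorem sum_antidiagonal_pfaffTerm (a b c w : ℂ) (N : ℕ) :
    ∑ p ∈ antidiagonal N, pfaffTerm a (c - b) c w p = hypCoeff a b c N * w ^ N := by
  have hvandermonde := sum_neg_one_pow_mul_choose_mul_poch c (c - b) N
  rw [sub_sub_cancel] at hvandermonde
  rw [Finset.Nat.sum_antidiagonal_eq_sum_range_succ_mk]
  trans ∑ k ∈ range (N + 1), poch a N / N.factorial * w ^ N *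
      (N.choose k * ((-1) ^ k * (poch (c - b) k * (Gamma (c + k))⁻¹)))
  · refine Finset.sum_congr rfl fun k hk => ?_
    rw [pfaffTerm_eq, Nat.add_sub_cancel' (Finset.mem_range_succ_iff.mp hk), hypCoeff_one_one,
      hypCoeff_one]
  · rw [← Finset.mul_sum, hvandermonde, hypCoeff]
    ring

theorem sub_one_ne_zero_of_norm_lt_one {w : ℂ} (hw : ‖w‖ < 1) : w - 1 ≠ 0 := by
  rw [sub_ne_zero]
  rintro rfl
  simp at hw

theorem hasSum_pfaffTerm_row (a d c : ℂ) {w : ℂ} (hw : ‖w‖ < 1) (k : ℕ) :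
    HasSum (fun m => pfaffTerm a d c w (k, m))
      ((1 - w) ^ (-a) * (hypCoeff a d c k * (w / (w - 1)) ^ k)) := by
  have hne : 1 - w ≠ 0 := neg_sub w 1 ▸ neg_ne_zero.mpr (sub_one_ne_zero_of_norm_lt_one hw)
  have hrow := (hasSum_poch_div_factorial (a + k) hw).mul_left
    (poch a k * ((-1) ^ k * (poch d k * (Gamma (c + k))⁻¹)) / k.factorial * w ^ k)
  convert! hrow using 1
  · funext m
    rw [pfaffTerm, poch_add, pow_add]
    ring
  · rw [hypCoeff, neg_add, Complex.cpow_add _ _ hne, Complex.cpow_neg _ (k : ℂ),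
      Complex.cpow_natCast, ← neg_sub 1 w, div_neg, neg_pow (w / (1 - w)), div_pow]
    ring

theorem tsum_eq_tsum_sum_antidiagonal {g : ℕ × ℕ → ℂ} (hg : Summable g) :
    ∑' p, g p = ∑' N, ∑ p ∈ antidiagonal N, g p := by
  rw [← sigmaAntidiagonalEquivProd.tsum_eq g]
  refine ((sigmaAntidiagonalEquivProd.summable_iff.mpr hg).tsum_sigma'
    fun n => (hasSum_fintype _).summable).trans (tsum_congr fun N => ?_)
  rw [tsum_fintype, Finset.univ_eq_attach]
  exact Finset.sum_attach (antidiagonal N) g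

/-- The continuation of the regularized Gauss series to the half-plane `Re w < 1/2` given by Pfaff's
transformation. -/
noncomputable def pfaffHyp (a b c w : ℂ) : ℂ :=
  (1 - w) ^ (-a) * regHypSeries a (c - b) c (w / (w - 1))

theorem regHypSeries_eq_pfaffHyp_of_norm_lt (a b c : ℂ) {w : ℂ} (hw : ‖w‖ < 1 / 8) :
    regHypSeries a b c w = pfaffHyp a b c w := by
  have hsum := summable_pfaffTerm a (c - b) c hw
  calc regHypSeries a b c w
      = ∑' N, ∑ p ∈ antidiagonal N, pfaffTerm a (c - b) c w p := by
        simp only [regHypSeries_eq_tsum, sum_antidiagonal_pfaffTerm]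
    _ = ∑' k, ∑' m, pfaffTerm a (c - b) c w (k, m) := by
        rw [← tsum_eq_tsum_sum_antidiagonal hsum, hsum.tsum_prod]
    _ = pfaffHyp a b c w := by
        simp only [(hasSum_pfaffTerm_row a (c - b) c (hw.trans (by norm_num)) _).tsum_eq,
          tsum_mul_left, pfaffHyp, regHypSeries_eq_tsum]

theorem sub_one_ne_zero_of_re_lt_half {w : ℂ} (hw : w.re < 1 / 2) : w - 1 ≠ 0 := by
  rw [sub_ne_zero]
  rintro rfl
  norm_num at hw

theorem norm_div_sub_one_lt_one {w : ℂ} (hw : w.re < 1 / 2) : ‖w / (w - 1)‖ < 1 := by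
  rw [norm_div, div_lt_one (norm_pos_iff.mpr (sub_one_ne_zero_of_re_lt_half hw)),
    ← sq_lt_sq₀ (norm_nonneg _) (norm_nonneg _), Complex.sq_norm, Complex.sq_norm,
    Complex.normSq_apply, Complex.normSq_apply]
  simp only [Complex.sub_re, Complex.sub_im, Complex.one_re, Complex.one_im]
  linarith

theorem isOpen_re_lt_half : IsOpen {w : ℂ | w.re < 1 / 2} :=
  isOpen_lt Complex.continuous_re continuous_const

theorem convex_re_lt_half : Convex ℝ {w : ℂ | w.re < 1 / 2} :=
  convex_halfSpace_re_lt _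

theorem differentiableOn_pfaffHyp (a b c : ℂ) :
    DifferentiableOn ℂ (pfaffHyp a b c) {w : ℂ | w.re < 1 / 2} := by
  intro w hw
  have hne := sub_one_ne_zero_of_re_lt_half hw
  have hpow : DifferentiableAt ℂ (fun w : ℂ => (1 - w) ^ (-a)) w :=
    DifferentiableAt.cpow (by fun_prop) (by fun_prop) (Or.inl (by
      simp only [Complex.sub_re, Complex.one_re]
      linarith [hw.out]))
  have hseries := (differentiableOn_regHypSeries a (c - b) c).differentiableAt
    (Metric.isOpen_ball.mem_nhds (mem_ball_zero_iff.mpr (norm_div_sub_one_lt_one hw)))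
  have hcomp := hseries.comp (f := fun w : ℂ => w / (w - 1)) w (by fun_prop (disch := assumption))
  exact (hpow.mul hcomp).differentiableWithinAt

theorem regHypSeries_eventuallyEq_pfaffHyp (a b c : ℂ) :
    regHypSeries a b c =ᶠ[𝓝 0] pfaffHyp a b c := by
  filter_upwards [Metric.ball_mem_nhds (0 : ℂ) (show (0 : ℝ) < 1 / 8 by norm_num)] with w hw
  exact regHypSeries_eq_pfaffHyp_of_norm_lt a b c (mem_ball_zero_iff.mp hw)

theorem regHypSeries_eq_pfaffHyp (a b c : ℂ) {w : ℂ} (hw : ‖w‖ < 1) (hw' : w.re < 1 / 2) :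
    regHypSeries a b c w = pfaffHyp a b c w := by
  have hU : IsOpen (Metric.ball (0 : ℂ) 1 ∩ {w : ℂ | w.re < 1 / 2}) :=
    Metric.isOpen_ball.inter isOpen_re_lt_half
  have hseries := ((differentiableOn_regHypSeries a b c).mono
    (Set.inter_subset_left (t := {w : ℂ | w.re < 1 / 2}))).analyticOnNhd hU
  have hpfaff := ((differentiableOn_pfaffHyp a b c).mono
    (Set.inter_subset_right (s := Metric.ball (0 : ℂ) 1))).analyticOnNhd hU
  exact hseries.eqOn_of_preconnected_of_eventuallyEq hpfaff
    ((convex_ball _ _).inter convex_re_lt_half).isPreconnected (z₀ := 0) (by simp)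
    (regHypSeries_eventuallyEq_pfaffHyp a b c) ⟨mem_ball_zero_iff.mpr hw, hw'⟩

theorem regHyp_eq_pfaffHyp (a b c : ℂ) {w : ℂ} (hw : w.re < 1 / 2) :
    regHyp a b c w = pfaffHyp a b c w := by
  rw [regHyp]
  split_ifs with hnorm hexists
  · exact regHypSeries_eq_pfaffHyp a b c hnorm hw
  all_goals
    have hpfaff : IsHypContinuation a b c w (pfaffHyp a b c w) :=
      ⟨{w : ℂ | w.re < 1 / 2}, pfaffHyp a b c, isOpen_re_lt_half,
        convex_re_lt_half.starConvex (by simp), hw, differentiableOn_pfaffHyp a b c,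
        (regHypSeries_eventuallyEq_pfaffHyp a b c).symm, rfl⟩
  · exact hexists.choose_spec.unique hpfaff
  · exact absurd ⟨_, hpfaff⟩ hexists

theorem pfaffHyp_neg_div_one_sub (a b c : ℂ) {w : ℂ} (hw : ‖w‖ < 1) :
    pfaffHyp a b c (-(w / (1 - w))) = (1 - w) ^ a * regHypSeries a (c - b) c w := by
  have hre : 0 < (1 - w).re := by
    rw [Complex.sub_re, Complex.one_re, sub_pos]
    exact (Complex.re_le_norm w).trans_lt hw
  have hne : 1 - w ≠ 0 := fun h => by simp [h] at hre
  have harg : (1 - w).arg ≠ Real.pi := fun h => by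
    rw [Complex.arg_eq_pi_iff] at h
    exact hre.not_gt h.1
  have hone_sub : 1 - -(w / (1 - w)) = (1 - w)⁻¹ := by
    field_simp
    ring
  have harg_eq : -(w / (1 - w)) / (-(w / (1 - w)) - 1) = w := by
    rw [← neg_sub 1, hone_sub]
    field_simp
  rw [pfaffHyp, harg_eq, hone_sub, Complex.inv_cpow _ _ harg, Complex.cpow_neg, inv_inv]

theorem regHypSeries_neg_div_one_sub (a b c : ℂ) {w : ℂ} (hw : ‖w‖ < 1)
    (hw' : ‖w / (1 - w)‖ < 1 / 8) :
    regHypSeries a b c (-(w / (1 - w))) = (1 - w) ^ a * regHypSeries a (c - b) c w := by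
  rw [regHypSeries_eq_pfaffHyp_of_norm_lt a b c (by rwa [norm_neg]),
    pfaffHyp_neg_div_one_sub a b c hw]

/-! ### Gegenbauer polynomials -/

/-- The three-term recurrence of the Gegenbauer polynomials in homogeneous form: for `s = σ ^ 2` it
is satisfied by the sequence `σ ^ n * C_n^μ(t / σ)`. -/
def GegenbauerRecurrence (μ t s : ℂ) (f : ℕ → ℂ) : Prop :=
  ∀ n : ℕ, (n + 2) * f (n + 2) = 2 * (n + 1 + μ) * t * f (n + 1) - (n + 2 * μ) * s * f n

theorem GegenbauerRecurrence.eq {μ t s : ℂ} {f g : ℕ → ℂ} (hf : GegenbauerRecurrence μ t s f)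
    (hg : GegenbauerRecurrence μ t s g) (h0 : f 0 = g 0) (h1 : f 1 = g 1) : f = g := by
  have hconsecutive (n : ℕ) : f n = g n ∧ f (n + 1) = g (n + 1) := by
    induction n with
    | zero => exact ⟨h0, h1⟩
    | succ n ih =>
      have hne : (n + 2 : ℂ) ≠ 0 := mod_cast (n + 1).succ_ne_zero
      exact ⟨ih.2, mul_left_cancel₀ hne (by rw [hf, hg, ih.1, ih.2])⟩
  exact funext fun n => (hconsecutive n).1

/-- The coefficient of `((1 - x) / 2) ^ k` in `C_n^μ(x)`. -/
noncomputable def gegenbauerCoeff (μ : ℂ) (n k : ℕ) : ℂ :=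
  poch (-(n : ℂ)) k * poch (2 * μ) (n + k) / (n.factorial * k.factorial * poch (μ + 1 / 2) k)

theorem gegenbauerCoeff_eq_zero_of_lt (μ : ℂ) {n k : ℕ} (hnk : n < k) :
    gegenbauerCoeff μ n k = 0 := by
  rw [gegenbauerCoeff, poch, ascPochhammer_eval_neg_coe_nat_of_lt hnk, zero_mul, zero_div]

theorem gegenbauerC_eq_sum (μ x : ℂ) {n N : ℕ} (hN : n < N) :
    gegenbauerC n μ x = ∑ k ∈ range N, gegenbauerCoeff μ n k * ((1 - x) / 2) ^ k := by
  have hterm (k : ℕ) : gegenbauerCoeff μ n k * ((1 - x) / 2) ^ k =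
      poch (2 * μ) n / n.factorial * (((k.factorial : ℂ)⁻¹ * poch (-(n : ℂ)) k *
        poch (2 * μ + n) k * (poch (μ + 1 / 2) k)⁻¹) • ((1 - x) / 2) ^ k) := by
    rw [gegenbauerCoeff, poch_add, smul_eq_mul]
    ring
  rw [gegenbauerC, ordinaryHypergeometric_eq_tsum, ← tsum_mul_left]
  simp only [← hterm]
  refine tsum_eq_sum fun k hk => ?_
  rw [gegenbauerCoeff_eq_zero_of_lt μ (hN.trans_le (not_lt.mp (Finset.mem_range.not.mp hk))),
    zero_mul]

theorem gegenbauerC_zero (μ x : ℂ) : gegenbauerC 0 μ x = 1 := by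
  simp [gegenbauerC_eq_sum μ x zero_lt_one, gegenbauerCoeff, poch_zero]

theorem gegenbauerCoeff_recurrence_zero (μ : ℂ) (n : ℕ) :
    (n + 2) * gegenbauerCoeff μ (n + 2) 0 - 2 * (n + 1 + μ) * gegenbauerCoeff μ (n + 1) 0 +
      (n + 2 * μ) * gegenbauerCoeff μ n 0 = 0 := by
  have hfac := factorial_ne_zero n
  have hsucc : (n + 1 : ℂ) ≠ 0 := n.cast_add_one_ne_zero
  have hsucc₂ : (n + 1 + 1 : ℂ) ≠ 0 := mod_cast (n + 1).cast_add_one_ne_zero (R := ℂ)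
  simp only [gegenbauerCoeff, poch_zero, add_zero, poch_succ, factorial_succ, Nat.factorial_zero,
    Nat.cast_add, Nat.cast_one]
  field_simp
  ring

section

variable {μ : ℂ} (hμ : ∀ k : ℕ, μ + 1 / 2 + k ≠ 0)
include hμ

theorem gegenbauerCoeff_recurrence_succ (n k : ℕ) :
    (n + 2) * gegenbauerCoeff μ (n + 2) (k + 1) -
      2 * (n + 1 + μ) * gegenbauerCoeff μ (n + 1) (k + 1) +
      (n + 2 * μ) * gegenbauerCoeff μ n (k + 1) =
      -4 * (n + 1 + μ) * gegenbauerCoeff μ (n + 1) k := by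
  have hnfac := factorial_ne_zero n
  have hkfac := factorial_ne_zero k
  have hn : (n + 1 : ℂ) ≠ 0 := n.cast_add_one_ne_zero
  have hn₂ : (n + 1 + 1 : ℂ) ≠ 0 := mod_cast (n + 1).cast_add_one_ne_zero (R := ℂ)
  have hk : (k + 1 : ℂ) ≠ 0 := k.cast_add_one_ne_zero
  have hpoch := poch_ne_zero hμ k
  have hhalf : 2 * μ + 1 + 2 * k ≠ 0 := fun h => hμ k (by linear_combination h / 2)
  have hpoch_upper : poch (-((n + 2 : ℕ) : ℂ)) (k + 1) =
      -(n + 2) * poch (-((n + 1 : ℕ) : ℂ)) k := by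
    rw [poch_succ_left]
    push_cast
    ring_nf
  have hpoch_lower : poch (-(n : ℂ)) (k + 1) =
      poch (-((n + 1 : ℕ) : ℂ)) k * (k - n - 1) * (n - k) / (n + 1) := by
    have h := mul_poch_add_one (-((n + 1 : ℕ) : ℂ)) (k + 1)
    rw [show -((n + 1 : ℕ) : ℂ) + 1 = -n by push_cast; ring,
      poch_succ (-((n + 1 : ℕ) : ℂ)) k] at h
    rw [eq_div_iff hn]
    push_cast at h ⊢
    linear_combination -h
  simp only [gegenbauerCoeff]
  rw [hpoch_upper, hpoch_lower, poch_succ (-((n + 1 : ℕ) : ℂ)), factorial_succ (n + 1),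
    factorial_succ n, factorial_succ k, show n + 2 + (k + 1) = n + k + 1 + 1 + 1 by ring,
    show n + 1 + (k + 1) = n + k + 1 + 1 by ring, show n + (k + 1) = n + k + 1 by ring,
    show n + 1 + k = n + k + 1 by ring, poch_succ (μ + 1 / 2),
    poch_succ (2 * μ) (n + k + 1 + 1), poch_succ (2 * μ) (n + k + 1),
    show μ + 1 / 2 + (k : ℂ) = (2 * μ + 1 + 2 * k) / 2 by ring]
  push_cast
  field_simp
  ring

theorem gegenbauerRecurrence_gegenbauerC (x : ℂ) :
    GegenbauerRecurrence μ x 1 fun n => gegenbauerC n μ x := by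
  intro n
  have hsum : (n + 2) * gegenbauerC (n + 2) μ x - 2 * (n + 1 + μ) * gegenbauerC (n + 1) μ x +
      (n + 2 * μ) * gegenbauerC n μ x =
      -4 * (n + 1 + μ) * ((1 - x) / 2) * gegenbauerC (n + 1) μ x := by
    conv_rhs => rw [gegenbauerC_eq_sum μ x (n + 1).lt_succ_self]
    rw [gegenbauerC_eq_sum μ x (n + 2).lt_succ_self,
      gegenbauerC_eq_sum μ x (show n + 1 < n + 2 + 1 by omega),
      gegenbauerC_eq_sum μ x (show n < n + 2 + 1 by omega), Finset.mul_sum, Finset.mul_sum,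
      Finset.mul_sum, ← Finset.sum_sub_distrib, ← Finset.sum_add_distrib, Finset.sum_range_succ',
      Finset.mul_sum, ← add_zero (∑ k ∈ range (n + 1).succ, _ * (_ * _ ^ k))]
    congr 1
    · refine Finset.sum_congr rfl fun k _ => ?_
      linear_combination ((1 - x) / 2) ^ (k + 1) * gegenbauerCoeff_recurrence_succ hμ n k
    · linear_combination gegenbauerCoeff_recurrence_zero μ n
  linear_combination hsum

theorem gegenbauerC_one (x : ℂ) : gegenbauerC 1 μ x = 2 * μ * x := by
  have hhalf : 2 * μ + 1 ≠ 0 := fun h => hμ 0 (by push_cast; linear_combination h / 2)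
  rw [gegenbauerC_eq_sum μ x (Nat.lt_add_one 1), Finset.sum_range_succ, Finset.sum_range_one]
  norm_num [gegenbauerCoeff, poch_zero, poch_succ]
  rw [show μ + 1 / 2 = (2 * μ + 1) / 2 by ring]
  field_simp
  ring

end

/-- The coefficient of `y ^ j * s ^ l` in the homogeneous polynomial `gegenbauerHom`. -/
noncomputable def gegenbauerHomCoeff (μ : ℂ) (j l : ℕ) : ℂ :=
  (-1) ^ l * poch μ (j + l) * 2 ^ j / (l.factorial * j.factorial)

/-- The `l`-th term of the homogeneous polynomial `gegenbauerHom`. -/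
noncomputable def gegenbauerHomTerm (μ y s : ℂ) (n l : ℕ) : ℂ :=
  if 2 * l ≤ n then gegenbauerHomCoeff μ (n - 2 * l) l * y ^ (n - 2 * l) * s ^ l else 0

/-- The homogenized Gegenbauer polynomial: it has weighted degree `n` when `y` has degree `1` and
`s` has degree `2`, and `C_n^μ(t)` is its value at `y = t`, `s = 1`. -/
noncomputable def gegenbauerHom (μ y s : ℂ) (n : ℕ) : ℂ :=
  ∑ l ∈ range (n + 1), gegenbauerHomTerm μ y s n l

theorem gegenbauerHomCoeff_zero_succ (μ : ℂ) (l : ℕ) :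
    (2 * l + 2) * gegenbauerHomCoeff μ 0 (l + 1) =
      -((2 * l + 2 * μ) * gegenbauerHomCoeff μ 0 l) := by
  have hfac := factorial_ne_zero l
  have hsucc : (l + 1 : ℂ) ≠ 0 := l.cast_add_one_ne_zero
  simp only [gegenbauerHomCoeff, factorial_succ, zero_add, poch_succ, pow_succ]
  field_simp
  ring

theorem gegenbauerHomCoeff_succ_zero (μ : ℂ) (j : ℕ) :
    (j + 1) * gegenbauerHomCoeff μ (j + 1) 0 = 2 * (j + μ) * gegenbauerHomCoeff μ j 0 := by
  have hfac := factorial_ne_zero j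
  have hsucc : (j + 1 : ℂ) ≠ 0 := j.cast_add_one_ne_zero
  simp only [gegenbauerHomCoeff, factorial_succ, add_zero, poch_succ, pow_succ]
  field_simp
  ring

theorem gegenbauerHomCoeff_succ_succ (μ : ℂ) (j l : ℕ) :
    (j + 2 * l + 3) * gegenbauerHomCoeff μ (j + 1) (l + 1) =
      2 * (j + 2 * l + 2 + μ) * gegenbauerHomCoeff μ j (l + 1) -
        (j + 2 * l + 1 + 2 * μ) * gegenbauerHomCoeff μ (j + 1) l := by
  have hjfac := factorial_ne_zero j
  have hlfac := factorial_ne_zero l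
  have hj : (j + 1 : ℂ) ≠ 0 := j.cast_add_one_ne_zero
  have hl : (l + 1 : ℂ) ≠ 0 := l.cast_add_one_ne_zero
  rw [gegenbauerHomCoeff, gegenbauerHomCoeff, gegenbauerHomCoeff,
    show j + 1 + (l + 1) = j + l + 1 + 1 by ring, show j + 1 + l = j + l + 1 by ring,
    show j + (l + 1) = j + l + 1 by ring]
  simp only [factorial_succ, poch_succ, pow_succ]
  push_cast
  field_simp
  ring

theorem gegenbauerHomTerm_recurrence_zero (μ y s : ℂ) (n : ℕ) :
    (n + 2) * gegenbauerHomTerm μ y s (n + 2) 0 =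
      2 * (n + 1 + μ) * y * gegenbauerHomTerm μ y s (n + 1) 0 := by
  have hcoeff := gegenbauerHomCoeff_succ_zero μ (n + 1)
  simp only [gegenbauerHomTerm, mul_zero, Nat.zero_le, if_true, Nat.sub_zero, pow_zero, mul_one]
  push_cast at hcoeff
  rw [pow_succ]
  linear_combination y ^ (n + 1) * y * hcoeff

theorem gegenbauerHomTerm_recurrence_succ (μ y s : ℂ) (n l : ℕ) :
    (n + 2) * gegenbauerHomTerm μ y s (n + 2) (l + 1) =
      2 * (n + 1 + μ) * y * gegenbauerHomTerm μ y s (n + 1) (l + 1) -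
        (n + 2 * μ) * s * gegenbauerHomTerm μ y s n l := by
  simp only [gegenbauerHomTerm]
  rcases lt_trichotomy n (2 * l) with hlt | rfl | hgt
  · rw [if_neg (by omega), if_neg (by omega), if_neg (by omega)]
    ring
  · have hcoeff := gegenbauerHomCoeff_zero_succ μ l
    rw [if_pos (by omega), if_neg (by omega), if_pos (by omega),
      show 2 * l + 2 - 2 * (l + 1) = 0 by omega, Nat.sub_self]
    push_cast
    linear_combination s ^ (l + 1) * hcoeff
  · obtain ⟨j, rfl⟩ := Nat.exists_eq_add_of_lt hgt
    have hcoeff := gegenbauerHomCoeff_succ_succ μ j l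
    rw [if_pos (by omega), if_pos (by omega), if_pos (by omega),
      show 2 * l + j + 1 + 2 - 2 * (l + 1) = j + 1 by omega,
      show 2 * l + j + 1 + 1 - 2 * (l + 1) = j by omega,
      show 2 * l + j + 1 - 2 * l = j + 1 by omega]
    push_cast
    linear_combination y ^ (j + 1) * s ^ (l + 1) * hcoeff

theorem gegenbauerHom_eq_sum (μ y s : ℂ) {n N : ℕ} (hN : n < N) :
    gegenbauerHom μ y s n = ∑ l ∈ range N, gegenbauerHomTerm μ y s n l := by
  refine Finset.sum_subset (Finset.range_mono hN) fun l _ hl => if_neg ?_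
  rw [Finset.mem_range] at hl
  omega

theorem gegenbauerRecurrence_gegenbauerHom (μ y s : ℂ) :
    GegenbauerRecurrence μ y s (gegenbauerHom μ y s) := by
  intro n
  rw [gegenbauerHom, gegenbauerHom_eq_sum μ y s (show n + 1 < n + 2 + 1 by omega),
    gegenbauerHom_eq_sum μ y s (show n < n + 2 by omega), Finset.sum_range_succ',
    Finset.sum_range_succ' _ (n + 2), mul_add, mul_add, gegenbauerHomTerm_recurrence_zero,
    Finset.mul_sum, Finset.mul_sum, Finset.mul_sum, add_sub_right_comm, ← Finset.sum_sub_distrib]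
  simp only [gegenbauerHomTerm_recurrence_succ]

theorem gegenbauerHom_zero (μ y s : ℂ) : gegenbauerHom μ y s 0 = 1 := by
  simp [gegenbauerHom, gegenbauerHomTerm, gegenbauerHomCoeff, poch_zero]

theorem gegenbauerHom_one (μ y s : ℂ) : gegenbauerHom μ y s 1 = 2 * μ * y := by
  simp [gegenbauerHom, Finset.sum_range_succ, gegenbauerHomTerm, gegenbauerHomCoeff, poch_zero,
    poch_succ, mul_comm]

open PowerSeries in
/-- The formal binomial series `(1 - αX) ^ (-μ)`. -/
noncomputable def binomSeries (μ α : ℂ) : PowerSeries ℂ :=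
  PowerSeries.mk fun k => poch μ k / k.factorial * α ^ k

open PowerSeries in
theorem one_sub_mul_derivative_binomSeries (μ α : ℂ) :
    (1 - C α * X) * derivative ℂ (binomSeries μ α) = C (μ * α) * binomSeries μ α := by
  ext n
  have hfac := factorial_ne_zero n
  have hsucc : (n + 1 : ℂ) ≠ 0 := n.cast_add_one_ne_zero
  have hcoeff : (n + 1) * (poch μ (n + 1) / (n + 1).factorial) =
      (μ + n) * (poch μ n / n.factorial) := by
    rw [poch_succ, factorial_succ]
    field_simp
  rcases n with _ | n
  · simp only [sub_mul, mul_assoc, one_mul, map_sub, coeff_C_mul, coeff_zero_X_mul, binomSeries,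
      coeff_derivative, coeff_mk]
    linear_combination α * hcoeff
  · simp only [sub_mul, mul_assoc, one_mul, map_sub, coeff_C_mul, coeff_succ_X_mul, binomSeries,
      coeff_derivative, coeff_mk]
    push_cast at hcoeff ⊢
    linear_combination α ^ (n + 2) * hcoeff

section

variable {μ : ℂ} (hμ : ∀ k : ℕ, μ + 1 / 2 + k ≠ 0)
include hμ

theorem gegenbauerHom_mul_sq (t σ : ℂ) (n : ℕ) :
    gegenbauerHom μ (σ * t) (σ ^ 2) n = σ ^ n * gegenbauerC n μ t := by
  have hrec : GegenbauerRecurrence μ (σ * t) (σ ^ 2) fun n => σ ^ n * gegenbauerC n μ t := by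
    intro n
    linear_combination σ ^ (n + 2) * gegenbauerRecurrence_gegenbauerC hμ t n
  refine congrFun ((gegenbauerRecurrence_gegenbauerHom μ _ _).eq hrec ?_ ?_) n
  · rw [gegenbauerHom_zero, gegenbauerC_zero, pow_zero, mul_one]
  · rw [gegenbauerHom_one, gegenbauerC_one hμ]
    ring

open PowerSeries in
theorem gegenbauerC_eq_coeff_binomSeries_mul {α β t : ℂ} (hmul : α * β = 1)
    (hadd : α + β = 2 * t) (n : ℕ) :
    gegenbauerC n μ t = coeff n (binomSeries μ α * binomSeries μ β) := by
  set G := binomSeries μ α * binomSeries μ β with hG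
  have hderiv : (1 - C (2 * t) * X + X * X) * derivative ℂ G = C (2 * μ) * ((C t - X) * G) := by
    have hα := one_sub_mul_derivative_binomSeries μ α
    have hβ := one_sub_mul_derivative_binomSeries μ β
    have hC_add : C α + C β = (2 * C t : PowerSeries ℂ) := by
      rw [← map_add, hadd, map_mul, map_ofNat]
    have hC_mul : (C α * C β : PowerSeries ℂ) = 1 := by rw [← map_mul, hmul, map_one]
    simp only [map_mul, map_ofNat] at hα hβ ⊢
    rw [hG, Derivation.leibniz, smul_eq_mul, smul_eq_mul]
    linear_combination (1 - C β * X) * binomSeries μ β * hα +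
      (1 - C α * X) * binomSeries μ α * hβ +
      (X * (binomSeries μ α * derivative ℂ (binomSeries μ β) +
        binomSeries μ β * derivative ℂ (binomSeries μ α)) +
        C μ * binomSeries μ α * binomSeries μ β) * hC_add -
      (X * X * (binomSeries μ α * derivative ℂ (binomSeries μ β) +
        binomSeries μ β * derivative ℂ (binomSeries μ α)) +
        2 * C μ * X * binomSeries μ α * binomSeries μ β) * hC_mul
  have hrec : GegenbauerRecurrence μ t 1 fun n => coeff n G := by
    intro n
    have hcoeff := congrArg (coeff (n + 1)) hderiv
    rcases n with _ | n <;>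
    · simp only [add_mul, sub_mul, mul_assoc, one_mul, map_sub, map_add, coeff_C_mul,
        coeff_zero_X_mul, coeff_succ_X_mul, coeff_derivative] at hcoeff
      push_cast at hcoeff ⊢
      linear_combination hcoeff
  refine congrFun ((gegenbauerRecurrence_gegenbauerC hμ t).eq hrec ?_ ?_) n
  · simp [hG, gegenbauerC_zero, coeff_mul, binomSeries, poch_zero]
  · simp [hG, gegenbauerC_one hμ, coeff_mul, binomSeries, poch_zero, poch_succ,
      Finset.Nat.antidiagonal_succ]
    linear_combination -μ * hadd

theorem exists_norm_gegenbauerC_mul_pow_le (γ : ℝ) {q : ℝ} (hq₀ : 0 < q) (hq₁ : q < 1) :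
    ∃ C : ℝ, 0 ≤ C ∧ ∀ n, ‖gegenbauerC n μ (Real.cos γ)‖ * q ^ n ≤ C := by
  set α := Complex.exp (γ * Complex.I) with hα
  set β := Complex.exp ((-γ : ℝ) * Complex.I) with hβ
  have hmul : α * β = 1 := by
    rw [hα, hβ, ← Complex.exp_add]
    simp
  have hadd : α + β = 2 * (Real.cos γ : ℂ) := by
    rw [hα, hβ, Complex.ofReal_cos, Complex.cos]
    push_cast
    ring
  have hnorm_q : ‖(q : ℂ)‖ = q := by rw [Complex.norm_real, Real.norm_of_nonneg hq₀.le]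
  have hsummable {a : ℂ} (ha : ‖a‖ = 1) :
      Summable fun k : ℕ => ‖poch μ k / k.factorial * a ^ k * (q : ℂ) ^ k‖ := by
    have haq : ‖a * q‖ < 1 := by rwa [norm_mul, ha, one_mul, hnorm_q]
    refine (summable_norm_hypCoeff μ 1 1 haq).congr fun k => ?_
    rw [hypCoeff_one_one, mul_pow, mul_assoc]
  obtain ⟨C, hC₀, hC⟩ := exists_norm_le_of_summable_norm
    (summable_norm_sum_mul_antidiagonal_of_summable_norm
      (hsummable (Complex.norm_exp_ofReal_mul_I γ))
      (hsummable (Complex.norm_exp_ofReal_mul_I (-γ))))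
  refine ⟨C, hC₀, fun n => (le_of_eq ?_).trans (hC n)⟩
  rw [gegenbauerC_eq_coeff_binomSeries_mul hμ hmul hadd, PowerSeries.coeff_mul]
  nth_rewrite 1 [← hnorm_q]
  rw [← norm_pow, ← norm_mul, Finset.sum_mul]
  refine congrArg norm (Finset.sum_congr rfl fun p hp => ?_)
  rw [← Finset.HasAntidiagonal.mem_antidiagonal.mp hp, pow_add]
  simp only [binomSeries, PowerSeries.coeff_mk]
  ring

end

/-! ### The addition theorem as an identity of formal double power series -/

/-- The zeroth order coefficient of the differential equation of order `μ + m` and degree `ν`, see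
`legendreOp`. -/
noncomputable def legendreConst (μ ν : ℂ) (m : ℕ) : ℂ :=
  (μ + m) * (μ + m + 1) - ν * (ν + 1)

/-- The recurrence satisfied at the point `z` by the successive derivatives of a solution of
`(z ^ 2 - 1) * F'' + 2 * (μ + 1) * z * F' + (μ * (μ + 1) - ν * (ν + 1)) * F = 0`. -/
def LegendreRecurrence (μ ν z : ℂ) (φ : ℕ → ℂ) : Prop :=
  ∀ m : ℕ, (z ^ 2 - 1) * φ (m + 2) + 2 * (μ + m + 1) * z * φ (m + 1) +
    legendreConst μ ν m * φ m = 0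

/-- The coefficient of `X ^ i * y ^ j` in the Taylor expansion of `F (c + c * X - s * y)`, where
`φ m` is the `m`-th derivative of `F` at `c`. -/
noncomputable def taylorCoeff (c s : ℂ) (φ : ℕ → ℂ) (i j : ℕ) : ℂ :=
  φ (i + j) * c ^ i * (-s) ^ j / (i.factorial * j.factorial)

theorem taylorCoeff_recurrence {μ ν c s : ℂ} {φ : ℕ → ℂ} (hs : s ^ 2 = c ^ 2 - 1)
    (hφ : LegendreRecurrence μ ν c φ) (i j : ℕ) :
    2 * (i + 1) * (i + j + 1 + μ) * taylorCoeff c s φ (i + 1) j +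
      (j + 2) * (j + 1) * taylorCoeff c s φ i (j + 2) +
      legendreConst μ ν (i + j) * taylorCoeff c s φ i j = 0 := by
  have hi := factorial_ne_zero i
  have hj := factorial_ne_zero j
  have hi₁ : (i + 1 : ℂ) ≠ 0 := i.cast_add_one_ne_zero
  have hj₁ : (j + 1 : ℂ) ≠ 0 := j.cast_add_one_ne_zero
  have hj₂ : (j + 1 + 1 : ℂ) ≠ 0 := mod_cast (j + 1).cast_add_one_ne_zero (R := ℂ)
  have h := hφ (i + j)
  simp only [taylorCoeff]
  rw [show i + 1 + j = i + j + 1 by ring, show i + (j + 2) = i + j + 2 by ring, factorial_succ i,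
    factorial_succ (j + 1), factorial_succ j]
  simp only [pow_succ]
  push_cast at h ⊢
  field_simp
  linear_combination (j + 2) * c ^ i * (-s) ^ j * (h + φ (i + j + 2) * hs)

section FormalSeries

open PowerSeries

/-- The power series `x ^ 2 - 1` in the variable `X = x - 1`. -/
noncomputable def sqSubOne : ℂ⟦X⟧ := 2 * X + X ^ 2

/-- The Legendre operator of order `μ + j` and degree `ν`, acting on power series in `X = x - 1`:
it annihilates `(x ^ 2 - 1) ^ (-(μ + j) / 2)` times a Legendre function of order `±(μ + j)`. -/
noncomputable def legendreOp (μ ν : ℂ) (j : ℕ) (f : ℂ⟦X⟧) : ℂ⟦X⟧ :=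
  sqSubOne * derivative ℂ (derivative ℂ f) + C (2 * (μ + j + 1)) * ((1 + X) * derivative ℂ f) +
    C (legendreConst μ ν j) * f

theorem coeff_legendreOp (μ ν : ℂ) (j : ℕ) (f : ℂ⟦X⟧) (i : ℕ) :
    coeff i (legendreOp μ ν j f) =
      2 * (i + 1) * (i + j + 1 + μ) * coeff (i + 1) f +
        legendreConst μ ν (i + j) * coeff i f := by
  rw [legendreOp, sqSubOne, ← map_ofNat C 2, sq]
  rcases i with _ | _ | i <;>
  · simp only [add_mul, mul_assoc, one_mul, map_add, coeff_C_mul, coeff_zero_X_mul,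
      coeff_succ_X_mul, coeff_derivative, legendreConst]
    push_cast
    ring_nf

theorem derivative_sqSubOne_pow_succ_mul (l : ℕ) (f : ℂ⟦X⟧) :
    derivative ℂ (sqSubOne ^ (l + 1) * f) =
      sqSubOne ^ l *
        (sqSubOne * derivative ℂ f + ((2 * (l + 1) : ℕ) : ℂ⟦X⟧) * ((1 + X) * f)) := by
  have hderiv : derivative ℂ sqSubOne = 2 * (1 + X) := by
    simp only [sqSubOne, two_mul, map_add, derivative_X, Derivation.leibniz_pow,
      Nat.add_one_sub_one, pow_one, smul_eq_mul, mul_one, nsmul_eq_mul, Nat.cast_ofNat]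
    ring
  rw [Derivation.leibniz, Derivation.leibniz_pow, hderiv, Nat.add_sub_cancel]
  simp only [smul_eq_mul, nsmul_eq_mul]
  push_cast
  ring

theorem sqSubOne_mul_derivative_pow_mul (l : ℕ) (f : ℂ⟦X⟧) :
    sqSubOne * derivative ℂ (sqSubOne ^ l * f) =
      sqSubOne ^ l * (sqSubOne * derivative ℂ f + ((2 * l : ℕ) : ℂ⟦X⟧) * ((1 + X) * f)) := by
  rcases l with _ | l
  · simp
  · rw [derivative_sqSubOne_pow_succ_mul, ← mul_assoc, ← pow_succ']

theorem legendreOp_sqSubOne_pow_mul (μ ν : ℂ) (j l : ℕ) (f : ℂ⟦X⟧) :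
    legendreOp μ ν j (sqSubOne ^ (l + 1) * f) =
      sqSubOne ^ (l + 1) * legendreOp μ ν (j + 2 * (l + 1)) f +
        C (4 * (l + 1) * (j + l + 1 + μ)) * (sqSubOne ^ l * f) := by
  have hconst : legendreConst μ ν (j + 2 * (l + 1)) =
      legendreConst μ ν j + 2 * (l + 1) * (2 * j + 2 * (l + 1) + 2 * μ + 1) := by
    simp only [legendreConst]
    push_cast
    ring
  have hsq : (1 + X : ℂ⟦X⟧) ^ 2 = sqSubOne + 1 := by rw [sqSubOne]; ring
  have hsecond : derivative ℂ
      (sqSubOne * derivative ℂ f + ((2 * (l + 1) : ℕ) : ℂ⟦X⟧) * ((1 + X) * f)) =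
      sqSubOne * derivative ℂ (derivative ℂ f) +
        ((2 * (l + 2) : ℕ) : ℂ⟦X⟧) * ((1 + X) * derivative ℂ f) +
        ((2 * (l + 1) : ℕ) : ℂ⟦X⟧) * f := by
    have hfirst := derivative_sqSubOne_pow_succ_mul 0 (derivative ℂ f)
    rw [zero_add, pow_one] at hfirst
    rw [map_add, hfirst]
    simp only [Derivation.leibniz, Derivation.map_natCast, map_add, derivative_X,
      Derivation.map_one_eq_zero, smul_eq_mul]
    push_cast
    ring
  rw [legendreOp, legendreOp, derivative_sqSubOne_pow_succ_mul, sqSubOne_mul_derivative_pow_mul,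
    hsecond, hconst]
  push_cast
  simp only [map_add, map_mul, map_ofNat, map_natCast, map_one]
  linear_combination sqSubOne ^ l * 4 * (l + 1) * (l + C μ + j + 1) * f * hsq

/-- The power series in `X = x - 1` of the regularized hypergeometric function
`₂F₁(1 + μ + n + ν, μ + n - ν; 1 + μ + n; (1 - x) / 2) / Γ(1 + μ + n)`, which is
`((x ^ 2 - 1) / 4) ^ (-(μ + n) / 2) * P_ν^{-(μ + n)}(x)`. -/
noncomputable def radialSeries (μ ν : ℂ) (n : ℕ) : ℂ⟦X⟧ :=
  PowerSeries.mk fun i => hypCoeff (1 + μ + n + ν) (μ + n - ν) (1 + μ + n) i * (-1 / 2) ^ i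

theorem legendreOp_radialSeries (μ ν : ℂ) (n : ℕ) :
    legendreOp μ ν n (radialSeries μ ν n) = 0 := by
  ext i
  have h := hypCoeff_succ (1 + μ + n + ν) (μ + n - ν) (1 + μ + n) i
  simp only [coeff_legendreOp, radialSeries, coeff_mk, legendreConst, pow_succ, map_zero]
  push_cast
  linear_combination -(-1 / 2) ^ i * h

theorem gegenbauerHomCoeff_harmonic (μ : ℂ) (j l : ℕ) :
    4 * (l + 1) * (j + l + 1 + μ) * gegenbauerHomCoeff μ j (l + 1) +
      (j + 2) * (j + 1) * gegenbauerHomCoeff μ (j + 2) l = 0 := by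
  have hj := factorial_ne_zero j
  have hl := factorial_ne_zero l
  have hj₁ : (j + 1 : ℂ) ≠ 0 := j.cast_add_one_ne_zero
  have hj₂ : (j + 1 + 1 : ℂ) ≠ 0 := mod_cast (j + 1).cast_add_one_ne_zero (R := ℂ)
  have hl₁ : (l + 1 : ℂ) ≠ 0 := l.cast_add_one_ne_zero
  rw [gegenbauerHomCoeff, gegenbauerHomCoeff, show j + (l + 1) = j + l + 1 by ring,
    show j + 2 + l = j + l + 1 + 1 by ring, poch_succ μ (j + l + 1), factorial_succ (j + 1),
    factorial_succ j, factorial_succ l]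
  simp only [pow_succ]
  push_cast
  field_simp
  ring

/-- The coefficient of `X ^ i * y ^ j` in `∑ₙ Bₙ * Kₙ(X) * Rₙ(y, x ^ 2 - 1)`, `x = 1 + X`, with `Kₙ`
the radial series and `Rₙ` the homogenized Gegenbauer polynomials. -/
noncomputable def expansionCoeff (μ ν : ℂ) (B : ℕ → ℂ) (i j : ℕ) : ℂ :=
  ∑ l ∈ range (i + 1), B (j + 2 * l) * gegenbauerHomCoeff μ j l *
    coeff i (sqSubOne ^ l * radialSeries μ ν (j + 2 * l))

theorem sqSubOne_pow_mul_eq (l : ℕ) (f : ℂ⟦X⟧) :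
    sqSubOne ^ l * f = X ^ l * ((2 + X) ^ l * f) := by
  rw [show sqSubOne = X * (2 + X) by rw [sqSubOne]; ring, mul_pow, mul_assoc]

theorem expansionCoeff_eq_sum (μ ν : ℂ) (B : ℕ → ℂ) {i N : ℕ} (hN : i < N) (j : ℕ) :
    expansionCoeff μ ν B i j = ∑ l ∈ range N, B (j + 2 * l) * gegenbauerHomCoeff μ j l *
      coeff i (sqSubOne ^ l * radialSeries μ ν (j + 2 * l)) := by
  refine Finset.sum_subset (Finset.range_mono hN) fun l _ hl => ?_
  rw [Finset.mem_range] at hl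
  rw [sqSubOne_pow_mul_eq, coeff_X_pow_mul', if_neg (by omega), mul_zero]

/-- The coefficient of `y ^ j * X ^ l * X ^ k` in the Gegenbauer expansion, see `expansionCoeff`,
when the factor `x ^ 2 - 1` of the homogenized Gegenbauer polynomials is split as `X * (2 + X)`. -/
noncomputable def tripleCoeff (μ ν : ℂ) (B : ℕ → ℂ) (j l k : ℕ) : ℂ :=
  B (j + 2 * l) * gegenbauerHomCoeff μ j l *
    coeff k ((2 + X) ^ l * radialSeries μ ν (j + 2 * l))

theorem expansionCoeff_eq_sum_antidiagonal (μ ν : ℂ) (B : ℕ → ℂ) (i j : ℕ) :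
    expansionCoeff μ ν B i j = ∑ p ∈ antidiagonal i, tripleCoeff μ ν B j p.1 p.2 := by
  rw [Finset.Nat.sum_antidiagonal_eq_sum_range_succ_mk, expansionCoeff]
  refine Finset.sum_congr rfl fun l hl => ?_
  rw [tripleCoeff, sqSubOne_pow_mul_eq, coeff_X_pow_mul', if_pos (Finset.mem_range_succ_iff.mp hl)]

/-- Both the Taylor expansion and the Gegenbauer expansion solve the same partial differential
equation in `X` and `y`; this is its form on coefficients for the latter, compare
`taylorCoeff_recurrence`. -/
theorem expansionCoeff_recurrence (μ ν : ℂ) (B : ℕ → ℂ) (i j : ℕ) :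
    2 * (i + 1) * (i + j + 1 + μ) * expansionCoeff μ ν B (i + 1) j +
      (j + 2) * (j + 1) * expansionCoeff μ ν B i (j + 2) +
      legendreConst μ ν (i + j) * expansionCoeff μ ν B i j = 0 := by
  have hfirst := congrArg (coeff i) (legendreOp_radialSeries μ ν j)
  have hterm (l : ℕ) : 2 * (i + 1) * (i + j + 1 + μ) *
        (B (j + 2 * (l + 1)) * gegenbauerHomCoeff μ j (l + 1) * coeff (i + 1)
          (sqSubOne ^ (l + 1) * radialSeries μ ν (j + 2 * (l + 1)))) +
      (j + 2) * (j + 1) * (B (j + 2 + 2 * l) * gegenbauerHomCoeff μ (j + 2) l *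
        coeff i (sqSubOne ^ l * radialSeries μ ν (j + 2 + 2 * l))) +
      legendreConst μ ν (i + j) * (B (j + 2 * (l + 1)) * gegenbauerHomCoeff μ j (l + 1) *
        coeff i (sqSubOne ^ (l + 1) * radialSeries μ ν (j + 2 * (l + 1)))) = 0 := by
    have hradial := congrArg (coeff i)
      (legendreOp_sqSubOne_pow_mul μ ν j l (radialSeries μ ν (j + 2 * (l + 1))))
    rw [legendreOp_radialSeries, mul_zero, zero_add, coeff_legendreOp, coeff_C_mul] at hradial
    rw [show j + 2 + 2 * l = j + 2 * (l + 1) by ring]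
    linear_combination B (j + 2 * (l + 1)) * gegenbauerHomCoeff μ j (l + 1) * hradial +
      B (j + 2 * (l + 1)) * coeff i (sqSubOne ^ l * radialSeries μ ν (j + 2 * (l + 1))) *
        gegenbauerHomCoeff_harmonic μ j l
  have hsum := Finset.sum_eq_zero fun l (_ : l ∈ range (i + 1)) => hterm l
  rw [Finset.sum_add_distrib, Finset.sum_add_distrib, ← Finset.mul_sum, ← Finset.mul_sum,
    ← Finset.mul_sum] at hsum
  rw [coeff_legendreOp, map_zero] at hfirst
  rw [expansionCoeff_eq_sum μ ν B (show i < i + 1 + 1 by omega) j, expansionCoeff, expansionCoeff,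
    Finset.sum_range_succ', Finset.sum_range_succ' _ (i + 1)]
  simp only [pow_zero, one_mul, mul_zero, add_zero]
  linear_combination hsum + B j * gegenbauerHomCoeff μ j 0 * hfirst

/-- The coefficient of the `n`-th term of the Gegenbauer expansion: it is determined by the
restriction of the expansion to `X = 0`. -/
noncomputable def additionCoeff (μ s : ℂ) (φ : ℕ → ℂ) (n : ℕ) : ℂ :=
  Gamma (1 + μ + n) * (-s) ^ n * φ n / (2 ^ n * poch μ n)

theorem Gamma_one_add_add_natCast_ne_zero {μ : ℂ} (hμ : ∀ n : ℕ, μ + n ≠ 0) (n : ℕ) :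
    Gamma (1 + μ + n) ≠ 0 :=
  Complex.Gamma_ne_zero fun m h =>
    hμ (n + m + 1) (by push_cast; linear_combination h)

theorem expansionCoeff_eq_taylorCoeff {μ ν c s : ℂ} {φ : ℕ → ℂ} (hμ : ∀ n : ℕ, μ + n ≠ 0)
    (hs : s ^ 2 = c ^ 2 - 1) (hφ : LegendreRecurrence μ ν c φ) (i j : ℕ) :
    expansionCoeff μ ν (additionCoeff μ s φ) i j = taylorCoeff c s φ i j := by
  induction i generalizing j with
  | zero =>
    have hGamma := Gamma_one_add_add_natCast_ne_zero hμ j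
    have hpoch := poch_ne_zero hμ j
    have hfac := factorial_ne_zero j
    simp only [expansionCoeff, taylorCoeff, additionCoeff, gegenbauerHomCoeff, radialSeries,
      hypCoeff, poch_zero, Finset.sum_range_one, zero_add, mul_zero, add_zero, pow_zero, one_mul,
      coeff_mk, Nat.factorial_zero, Nat.cast_zero, Nat.cast_one, mul_one]
    field_simp
  | succ i ih =>
    have hexpansion := expansionCoeff_recurrence μ ν (additionCoeff μ s φ) i j
    rw [ih, ih] at hexpansion
    have hi : (i + 1 : ℂ) ≠ 0 := i.cast_add_one_ne_zero
    have hij : (i + j + 1 + μ : ℂ) ≠ 0 := fun h =>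
      hμ (i + j + 1) (by push_cast; linear_combination h)
    refine mul_left_cancel₀ (mul_ne_zero (mul_ne_zero two_ne_zero hi) hij) ?_
    linear_combination hexpansion - taylorCoeff_recurrence hs hφ i j

end FormalSeries

/-! ### Growth of the coefficients -/

theorem norm_poch_le {a : ℂ} {N : ℕ} (ha : ‖a‖ ≤ N) (i : ℕ) :
    ‖poch a i‖ ≤ i.factorial * 2 ^ (N + i) := by
  have hasc : ‖poch a i‖ ≤ ((N + 1).ascFactorial i : ℝ) := by
    induction i with
    | zero => simp [poch_zero]
    | succ i ih =>
      have hnorm : ‖a + i‖ ≤ ((N + 1 + i : ℕ) : ℝ) := by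
        refine (norm_add_le _ _).trans ?_
        rw [Complex.norm_natCast]
        push_cast
        linarith
      rw [poch_succ, Nat.ascFactorial_succ, norm_mul, mul_comm, Nat.cast_mul]
      gcongr
  refine hasc.trans ?_
  rw [Nat.ascFactorial_eq_factorial_mul_choose]
  exact_mod_cast Nat.mul_le_mul_left _ (Nat.choose_le_two_pow _ _)

theorem norm_poch_le_pow_mul_norm_poch {a b : ℂ} {A : ℝ} (h : ∀ k : ℕ, ‖a + k‖ ≤ A * ‖b + k‖)
    (i : ℕ) : ‖poch a i‖ ≤ A ^ i * ‖poch b i‖ := by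
  induction i with
  | zero => simp [poch_zero]
  | succ i ih =>
    rw [poch_succ, poch_succ, norm_mul, norm_mul, pow_succ, mul_mul_mul_comm]
    exact mul_le_mul ih (h i) (norm_nonneg _) ((norm_nonneg _).trans ih)

theorem tendsto_norm_add_div_add (a b : ℂ) :
    Tendsto (fun n : ℕ => ‖(a + n) / (b + n)‖) atTop (𝓝 1) := by
  have hinfty : Tendsto (fun n : ℕ => b + n) atTop (Bornology.cobounded ℂ) :=
    (tendsto_const_add_cobounded b).comp tendsto_natCast_atTop_cobounded
  have hquot := (((tendsto_inv₀_cobounded.comp hinfty).const_mul (a - b)).const_add 1).norm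
  rw [mul_zero, add_zero, norm_one] at hquot
  refine hquot.congr' ?_
  filter_upwards [hinfty.eventually_ne_cobounded 0] with n hn
  congr 1
  simp only [Function.comp_apply]
  field_simp
  ring

theorem exists_norm_add_le_mul_norm (a : ℂ) {b : ℂ} (hb : ∀ n : ℕ, b + n ≠ 0) :
    ∃ A : ℝ, 1 ≤ A ∧ ∀ n : ℕ, ‖a + n‖ ≤ A * ‖b + n‖ := by
  obtain ⟨A, hA⟩ := (tendsto_norm_add_div_add a b).bddAbove_range
  refine ⟨max 1 A, le_max_left _ _, fun n => ?_⟩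
  rw [← div_le_iff₀ (norm_pos_iff.mpr (hb n)), ← norm_div]
  exact (hA ⟨n, rfl⟩).trans (le_max_right _ _)

theorem eventually_norm_add_le_mul_norm (a : ℂ) {b : ℂ} (hb : ∀ n : ℕ, b + n ≠ 0) {A : ℝ}
    (hA : 1 < A) : ∀ᶠ n : ℕ in atTop, ‖a + n‖ ≤ A * ‖b + n‖ := by
  filter_upwards [(tendsto_norm_add_div_add a b).eventually_le_const hA] with n hn
  rwa [norm_div, div_le_iff₀ (norm_pos_iff.mpr (hb n))] at hn

theorem Gamma_mul_hypCoeff {c : ℂ} (hc : ∀ k : ℕ, c + k ≠ 0) (a b : ℂ) (i : ℕ) :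
    Gamma c * hypCoeff a b c i = poch a i / poch c i * (poch b i / i.factorial) := by
  have hGamma : Gamma c ≠ 0 :=
    Complex.Gamma_ne_zero fun m h => hc m (by linear_combination h)
  have hpoch := poch_ne_zero hc i
  have hshift : (Gamma (c + i))⁻¹ = (Gamma c)⁻¹ / poch c i := by
    rw [eq_div_iff hpoch, mul_comm, poch_mul_inv_Gamma]
  rw [hypCoeff, hshift]
  field_simp

theorem exists_norm_factorial_div_poch_mul_pow_le {μ : ℂ} (hμ : ∀ n : ℕ, μ + n ≠ 0) {q : ℝ}
    (hq₀ : 0 ≤ q) (hq₁ : q < 1) :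
    ∃ C : ℝ, 0 ≤ C ∧ ∀ n : ℕ, ‖(n.factorial : ℂ) / poch μ n‖ * q ^ n ≤ C := by
  obtain ⟨C, hC, hbound⟩ := exists_norm_hypCoeff_mul_pow_le 1 1 μ hq₀ hq₁
  refine ⟨‖Gamma μ‖ * C, by positivity, fun n => ?_⟩
  have hquot := Gamma_mul_hypCoeff hμ 1 1 n
  rw [poch_one, div_self (factorial_ne_zero n), mul_one] at hquot
  rw [← hquot, norm_mul, mul_assoc]
  exact mul_le_mul_of_nonneg_left (hbound n) (norm_nonneg _)

theorem factorial_add_div_le_two_pow (j l : ℕ) :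
    ((j + l).factorial : ℝ) / (j.factorial * l.factorial) ≤ 2 ^ (j + l) := by
  rw [← Nat.cast_add_choose]
  exact_mod_cast Nat.choose_le_two_pow (j + l) j

theorem norm_gegenbauerHomCoeff_le {μ : ℂ} {N : ℕ} (hN : ‖μ‖ ≤ N) (j l : ℕ) :
    ‖gegenbauerHomCoeff μ j l‖ ≤ 2 ^ N * 8 ^ j * 4 ^ l := by
  rw [gegenbauerHomCoeff]
  simp only [norm_mul, norm_div, norm_pow, norm_neg, norm_one, one_pow, one_mul,
    Complex.norm_natCast, Complex.norm_ofNat]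
  calc ‖poch μ (j + l)‖ * 2 ^ j / (l.factorial * j.factorial)
      ≤ ((j + l).factorial * 2 ^ (N + (j + l))) * 2 ^ j / (l.factorial * j.factorial) := by
        gcongr
        exact norm_poch_le hN (j + l)
    _ = ((j + l).factorial : ℝ) / (j.factorial * l.factorial) * (2 ^ (N + (j + l)) * 2 ^ j) := by
      ring
    _ ≤ 2 ^ (j + l) * (2 ^ (N + (j + l)) * 2 ^ j) := by
      gcongr
      exact factorial_add_div_le_two_pow j l
    _ = 2 ^ N * 8 ^ j * 4 ^ l := by
      rw [show (8 : ℝ) = 2 * 2 * 2 by norm_num, show (4 : ℝ) = 2 * 2 by norm_num]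
      simp only [mul_pow, pow_add]
      ring

section Growth

open PowerSeries

theorem norm_Gamma_mul_coeff_radialSeries_le {μ ν : ℂ} (hμ : ∀ n : ℕ, μ + n ≠ 0) {A : ℝ}
    (hA : ∀ n : ℕ, ‖μ + ν + n‖ ≤ A * ‖μ + n‖) {N : ℕ} (hN : ‖μ - ν‖ ≤ N) (n i : ℕ) :
    ‖Gamma (1 + μ + n) * coeff i (radialSeries μ ν n)‖ ≤ 2 ^ (N + n) * A ^ i := by
  have hshift (k : ℕ) : 1 + μ + n + k = μ + (n + k + 1 : ℕ) := by push_cast; ring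
  have hne (k : ℕ) : 1 + μ + n + k ≠ 0 := hshift k ▸ hμ _
  have hquot : ‖poch (1 + μ + n + ν) i / poch (1 + μ + n) i‖ ≤ A ^ i := by
    rw [norm_div, div_le_iff₀ (norm_pos_iff.mpr (poch_ne_zero hne i))]
    refine norm_poch_le_pow_mul_norm_poch (fun k => ?_) i
    rw [hshift, show 1 + μ + n + ν + k = μ + ν + (n + k + 1 : ℕ) by push_cast; ring]
    exact hA _
  have hpoch : ‖poch (μ + n - ν) i / (i.factorial : ℂ)‖ ≤ 2 ^ (N + n + i) := by
    rw [norm_div, Complex.norm_natCast, div_le_iff₀ (by positivity), mul_comm]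
    refine norm_poch_le ?_ i
    rw [add_sub_right_comm, Nat.cast_add]
    exact (norm_add_le _ _).trans (by rw [Complex.norm_natCast]; gcongr)
  rw [radialSeries, coeff_mk, ← mul_assoc, Gamma_mul_hypCoeff hne, norm_mul, norm_mul]
  calc _ ≤ A ^ i * 2 ^ (N + n + i) * ‖(-1 / 2 : ℂ) ^ i‖ := by
        gcongr
        exact (norm_nonneg _).trans hquot
    _ = 2 ^ (N + n) * A ^ i := by
      rw [norm_pow, norm_div, norm_neg, norm_one, Complex.norm_ofNat, pow_add, div_pow, one_pow]
      field_simp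

theorem norm_coeff_two_add_X_pow_mul_le {f : ℂ⟦X⟧} {M A : ℝ} (hA : 1 ≤ A) (hM : 0 ≤ M)
    (hf : ∀ k, ‖coeff k f‖ ≤ M * A ^ k) (l k : ℕ) :
    ‖coeff k ((2 + X) ^ l * f)‖ ≤ 3 ^ l * M * A ^ k := by
  induction l generalizing k with
  | zero => simpa using hf k
  | succ l ih =>
    have hA₀ : 0 ≤ A := zero_le_one.trans hA
    rw [pow_succ', mul_assoc, add_mul, map_add, ← map_ofNat C 2, coeff_C_mul, map_ofNat]
    rcases k with _ | k
    · rw [coeff_zero_X_mul, add_zero, norm_mul, Complex.norm_ofNat]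
      calc _ ≤ 2 * (3 ^ l * M * A ^ 0) := by gcongr; exact ih 0
        _ ≤ 3 * (3 ^ l * M * A ^ 0) := by gcongr; norm_num
        _ = _ := by ring
    · rw [coeff_succ_X_mul]
      refine (norm_add_le _ _).trans ?_
      rw [norm_mul, Complex.norm_ofNat]
      calc _ ≤ 2 * (3 ^ l * M * A ^ (k + 1)) + 3 ^ l * M * A ^ k := by
            gcongr
            exacts [ih (k + 1), ih k]
        _ ≤ 2 * (3 ^ l * M * A ^ (k + 1)) + 3 ^ l * M * A ^ (k + 1) := by
          gcongr
          exact k.le_succ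
        _ = _ := by ring

theorem exists_norm_additionCoeff_le {μ : ℂ} (hμ : ∀ n : ℕ, μ + n ≠ 0) (s : ℂ) {φ : ℕ → ℂ}
    {C D : ℝ} (hφ : ∀ n, ‖φ n‖ ≤ C * D ^ n * n.factorial) :
    ∃ K : ℝ, ∀ n, ‖additionCoeff μ s φ n‖ ≤ ‖Gamma (1 + μ + n)‖ * (K * (‖s‖ * D) ^ n) := by
  obtain ⟨C₁, -, hC₁⟩ := exists_norm_factorial_div_poch_mul_pow_le hμ (q := 1 / 2) (by norm_num)
    (by norm_num)
  refine ⟨C * C₁, fun n => ?_⟩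
  have hfac : (0 : ℝ) < n.factorial := mod_cast n.factorial_pos
  have hsplit : additionCoeff μ s φ n =
      Gamma (1 + μ + n) * ((-s / 2) ^ n * (φ n / n.factorial) * (n.factorial / poch μ n)) := by
    have hfac_ne := factorial_ne_zero n
    rw [additionCoeff, div_pow]
    field_simp
  have hφn : ‖φ n / n.factorial‖ ≤ C * D ^ n := by
    rw [norm_div, Complex.norm_natCast, div_le_iff₀ hfac]
    exact hφ n
  rw [hsplit, norm_mul, norm_mul, norm_mul, norm_pow, norm_div, norm_neg, Complex.norm_ofNat]
  refine mul_le_mul_of_nonneg_left ?_ (norm_nonneg _)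
  calc (‖s‖ / 2) ^ n * ‖φ n / n.factorial‖ * ‖n.factorial / poch μ n‖
      = ‖s‖ ^ n * ‖φ n / n.factorial‖ * (‖n.factorial / poch μ n‖ * (1 / 2) ^ n) := by
        rw [div_pow, div_pow, one_pow]
        ring
    _ ≤ ‖s‖ ^ n * (C * D ^ n) * C₁ := by
        gcongr
        exacts [mul_nonneg (by positivity) ((norm_nonneg _).trans hφn), hC₁ n]
    _ = C * C₁ * (‖s‖ * D) ^ n := by
        rw [mul_pow]
        ring

theorem exists_norm_tripleCoeff_le {μ : ℂ} (hμ : ∀ n : ℕ, μ + n ≠ 0) (ν : ℂ) {B : ℕ → ℂ}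
    {K D : ℝ} (hD : 0 ≤ D) (hB : ∀ n, ‖B n‖ ≤ ‖Gamma (1 + μ + n)‖ * (K * D ^ n)) :
    ∃ C M : ℝ, 0 ≤ M ∧ ∀ j l k, ‖tripleCoeff μ ν B j l k‖ ≤ C * (M ^ j * (M ^ l * M ^ k)) := by
  obtain ⟨N₁, hN₁⟩ := exists_nat_ge ‖μ‖
  obtain ⟨N₂, hN₂⟩ := exists_nat_ge ‖μ - ν‖
  obtain ⟨A, hA₁, hA⟩ := exists_norm_add_le_mul_norm (μ + ν) hμ
  have hGamma (n : ℕ) : 0 < ‖Gamma (1 + μ + n)‖ :=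
    norm_pos_iff.mpr (Gamma_one_add_add_natCast_ne_zero hμ n)
  have hKD (n : ℕ) : 0 ≤ K * D ^ n :=
    nonneg_of_mul_nonneg_right ((norm_nonneg _).trans (hB n)) (hGamma n)
  have hK : 0 ≤ K := by simpa using hKD 0
  refine ⟨K * 2 ^ N₁ * 2 ^ N₂, A + 16 * D + 48 * D ^ 2, by positivity, fun j l k => ?_⟩
  set n := j + 2 * l with hn
  have hradial : ‖Gamma (1 + μ + n)‖ * ‖coeff k ((2 + X) ^ l * radialSeries μ ν n)‖ ≤
      3 ^ l * 2 ^ (N₂ + n) * A ^ k := by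
    have h := norm_coeff_two_add_X_pow_mul_le (f := C (Gamma (1 + μ + n)) * radialSeries μ ν n)
      (M := 2 ^ (N₂ + n)) hA₁ (by positivity) (fun i => by
        rw [coeff_C_mul]
        exact norm_Gamma_mul_coeff_radialSeries_le hμ hA hN₂ n i) l k
    rwa [mul_left_comm, coeff_C_mul, norm_mul] at h
  calc ‖tripleCoeff μ ν B j l k‖
      = ‖B n‖ * ‖gegenbauerHomCoeff μ j l‖ *
          ‖coeff k ((2 + X) ^ l * radialSeries μ ν n)‖ := by
        rw [tripleCoeff, norm_mul, norm_mul]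
    _ ≤ ‖Gamma (1 + μ + n)‖ * (K * D ^ n) * (2 ^ N₁ * 8 ^ j * 4 ^ l) *
          ‖coeff k ((2 + X) ^ l * radialSeries μ ν n)‖ := by
        gcongr
        exacts [hB n, norm_gegenbauerHomCoeff_le hN₁ j l]
    _ = K * D ^ n * (2 ^ N₁ * 8 ^ j * 4 ^ l) *
          (‖Gamma (1 + μ + n)‖ * ‖coeff k ((2 + X) ^ l * radialSeries μ ν n)‖) := by ring
    _ ≤ K * D ^ n * (2 ^ N₁ * 8 ^ j * 4 ^ l) * (3 ^ l * 2 ^ (N₂ + n) * A ^ k) := by gcongr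
    _ = K * 2 ^ N₁ * 2 ^ N₂ *
          ((8 * 2 * D) ^ j * ((4 * 3 * 2 ^ 2 * D ^ 2) ^ l * A ^ k)) := by
        rw [hn]
        simp only [mul_pow, pow_add, pow_mul]
        ring
    _ ≤ _ := by
        gcongr <;> nlinarith

end Growth

/-! ### The addition theorem near `x = 1`, `y = 0` -/

section Germ

open PowerSeries

theorem hasSum_coeff_two_add_X_pow_mul {f : ℂ⟦X⟧} {z S : ℂ}
    (hf : HasSum (fun k => coeff k f * z ^ k) S) (l : ℕ) :
    HasSum (fun k => coeff k ((2 + X) ^ l * f) * z ^ k) ((2 + z) ^ l * S) := by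
  induction l with
  | zero => simpa using hf
  | succ l ih =>
    have hshift : HasSum (fun k => coeff k (X * ((2 + X) ^ l * f)) * z ^ k)
        (z * ((2 + z) ^ l * S)) := by
      rw [hasSum_nat_add_iff' 1 |>.symm]
      simpa [coeff_succ_X_mul, pow_succ', mul_left_comm] using ih.mul_left z
    rw [pow_succ', pow_succ', mul_assoc, mul_assoc, add_mul, add_mul]
    refine ((ih.mul_left 2).add hshift).congr_fun fun k => ?_
    rw [map_add, ← map_ofNat C 2, coeff_C_mul]
    ring

theorem hasSum_radialSeries (μ ν : ℂ) (n : ℕ) {z : ℂ} (hz : ‖z‖ < 1) :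
    HasSum (fun k => coeff k (radialSeries μ ν n) * z ^ k)
      (regHypSeries (1 + μ + n + ν) (μ + n - ν) (1 + μ + n) (-z / 2)) := by
  have hnorm : ‖-z / 2‖ < 1 := by
    rw [norm_div, norm_neg, Complex.norm_ofNat]
    linarith [norm_nonneg z]
  refine (hasSum_regHypSeries _ _ _ hnorm).congr_fun fun k => ?_
  rw [radialSeries, coeff_mk, show -z / 2 = -1 / 2 * z by ring, mul_pow, mul_assoc]

theorem summable_tripleCoeff {μ ν : ℂ} {B : ℕ → ℂ} {C M : ℝ} (hM : 0 ≤ M)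
    (hB : ∀ j l k, ‖tripleCoeff μ ν B j l k‖ ≤ C * (M ^ j * (M ^ l * M ^ k))) {z y : ℂ}
    (hz : M * ‖z‖ < 1) (hy : M * ‖y‖ < 1) :
    Summable fun p : ℕ × ℕ × ℕ =>
      tripleCoeff μ ν B p.1 p.2.1 p.2.2 * z ^ (p.2.1 + p.2.2) * y ^ p.1 := by
  have hgeom (w : ℂ) : 0 ≤ fun n : ℕ => (M * ‖w‖) ^ n := fun n => by positivity
  have hgeomz := summable_geometric_of_lt_one (by positivity) hz
  have hgeomzz := hgeomz.mul_of_nonneg hgeomz (hgeom z) (hgeom z)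
  have hgeomy := summable_geometric_of_lt_one (by positivity) hy
  refine Summable.of_norm_bounded ((hgeomy.mul_of_nonneg hgeomzz (hgeom y)
    fun p => mul_nonneg (hgeom z p.1) (hgeom z p.2)).mul_left C) fun ⟨j, l, k⟩ => ?_
  simp only [norm_mul, norm_pow]
  calc _ ≤ C * (M ^ j * (M ^ l * M ^ k)) * ‖z‖ ^ (l + k) * ‖y‖ ^ j := by
        gcongr
        exact hB j l k
    _ = C * ((M * ‖y‖) ^ j * ((M * ‖z‖) ^ l * (M * ‖z‖) ^ k)) := by
        simp only [mul_pow, pow_add]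
        ring

theorem summable_taylorCoeff {c s : ℂ} {φ : ℕ → ℂ} {C D : ℝ} (hD : 0 ≤ D)
    (hφ : ∀ n, ‖φ n‖ ≤ C * D ^ n * n.factorial) {z y : ℂ}
    (hz : 2 * D * ‖c‖ * ‖z‖ < 1) (hy : 2 * D * ‖s‖ * ‖y‖ < 1) :
    Summable fun p : ℕ × ℕ => taylorCoeff c s φ p.2 p.1 * z ^ p.2 * y ^ p.1 := by
  have hC : 0 ≤ C := by simpa using (norm_nonneg _).trans (hφ 0)
  have hgeomz := summable_geometric_of_lt_one (by positivity) hz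
  have hgeomy := summable_geometric_of_lt_one (by positivity) hy
  refine Summable.of_norm_bounded ((hgeomy.mul_of_nonneg hgeomz (fun n => by positivity)
    fun n => by positivity).mul_left C) fun ⟨j, i⟩ => ?_
  simp only [taylorCoeff, norm_mul, norm_div, norm_pow, norm_neg, Complex.norm_natCast]
  calc _ ≤ C * D ^ (i + j) * (i + j).factorial * ‖c‖ ^ i * ‖s‖ ^ j /
        (i.factorial * j.factorial) * ‖z‖ ^ i * ‖y‖ ^ j := by
        gcongr
        exact hφ _
    _ = ((i + j).factorial : ℝ) / (i.factorial * j.factorial) *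
        (C * D ^ (i + j) * ‖c‖ ^ i * ‖s‖ ^ j * ‖z‖ ^ i * ‖y‖ ^ j) := by ring
    _ ≤ 2 ^ (i + j) * (C * D ^ (i + j) * ‖c‖ ^ i * ‖s‖ ^ j * ‖z‖ ^ i * ‖y‖ ^ j) := by
        gcongr
        exact factorial_add_div_le_two_pow i j
    _ = C * ((2 * D * ‖s‖ * ‖y‖) ^ j * (2 * D * ‖c‖ * ‖z‖) ^ i) := by
        simp only [mul_pow, pow_add]
        ring

theorem sum_antidiagonal_taylorCoeff (c s : ℂ) (φ : ℕ → ℂ) (z y : ℂ) (m : ℕ) :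
    ∑ p ∈ antidiagonal m, taylorCoeff c s φ p.2 p.1 * z ^ p.2 * y ^ p.1 =
      φ m / m.factorial * (c * z - s * y) ^ m := by
  rw [show c * z - s * y = -s * y + c * z by ring, (Commute.all _ _).add_pow', Finset.mul_sum]
  refine Finset.sum_congr rfl fun p hp => ?_
  obtain rfl := Finset.HasAntidiagonal.mem_antidiagonal.mp hp
  have hfst := factorial_ne_zero p.1
  have hsnd := factorial_ne_zero p.2
  have hadd := factorial_ne_zero (p.1 + p.2)
  rw [taylorCoeff, add_comm p.2 p.1, nsmul_eq_mul, Nat.cast_add_choose, mul_pow, mul_pow]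
  field_simp

theorem tsum_mul_gegenbauerHom (μ y s : ℂ) (B : ℕ → ℂ) (hsum : Summable fun p : ℕ × ℕ =>
      B (p.1 + 2 * p.2) * gegenbauerHomCoeff μ p.1 p.2 * y ^ p.1 * s ^ p.2) :
    ∑' p : ℕ × ℕ, B (p.1 + 2 * p.2) * gegenbauerHomCoeff μ p.1 p.2 * y ^ p.1 * s ^ p.2 =
      ∑' n, B n * gegenbauerHom μ y s n := by
  set g : ℕ × ℕ → ℂ := fun p => B p.1 * gegenbauerHomTerm μ y s p.1 p.2 with hg
  set e : ℕ × ℕ → ℕ × ℕ := fun p => (p.1 + 2 * p.2, p.2) with he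
  have he_inj : Function.Injective e := by
    rintro ⟨j, l⟩ ⟨j', l'⟩ h
    simp only [he, Prod.mk.injEq] at h ⊢
    omega
  have hg_zero {n l : ℕ} (hl : n < 2 * l) : g (n, l) = 0 := by
    simp only [hg, gegenbauerHomTerm]
    rw [if_neg (by omega), mul_zero]
  have hg_off_range : ∀ p ∉ Set.range e, g p = 0 := by
    rintro ⟨n, l⟩ hp
    refine hg_zero (lt_of_not_ge fun hl => hp ⟨(n - 2 * l, l), ?_⟩)
    simp only [he, Nat.sub_add_cancel hl]
  have hg_comp : (fun p : ℕ × ℕ => B (p.1 + 2 * p.2) * gegenbauerHomCoeff μ p.1 p.2 *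
      y ^ p.1 * s ^ p.2) = g ∘ e := by
    funext p
    simp only [hg, he, Function.comp_apply, gegenbauerHomTerm]
    rw [if_pos (by omega), Nat.add_sub_cancel]
    ring
  rw [hg_comp] at hsum ⊢
  have hg_summable : Summable g := (he_inj.summable_iff hg_off_range).mp hsum
  refine (he_inj.tsum_eq fun p hp => by_contra fun h => hp (hg_off_range p h)).trans ?_
  rw [hg_summable.tsum_prod]
  refine tsum_congr fun n => ?_
  rw [gegenbauerHom, Finset.mul_sum]
  exact tsum_eq_sum fun l hl => hg_zero (by rw [Finset.mem_range] at hl; omega)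

theorem tsum_tripleCoeff_eq_tsum_gegenbauerHom {μ ν : ℂ} {B : ℕ → ℂ} {z y : ℂ} (hz : ‖z‖ < 1)
    (hsum : Summable fun p : ℕ × ℕ × ℕ =>
      tripleCoeff μ ν B p.1 p.2.1 p.2.2 * z ^ (p.2.1 + p.2.2) * y ^ p.1) :
    ∑' p : ℕ × ℕ × ℕ, tripleCoeff μ ν B p.1 p.2.1 p.2.2 * z ^ (p.2.1 + p.2.2) * y ^ p.1 =
      ∑' n : ℕ, B n * regHypSeries (1 + μ + n + ν) (μ + n - ν) (1 + μ + n) (-z / 2) *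
        gegenbauerHom μ y (2 * z + z ^ 2) n := by
  have hinner (p : ℕ × ℕ) :
      ∑' k, tripleCoeff μ ν B p.1 p.2 k * z ^ (p.2 + k) * y ^ p.1 =
        B (p.1 + 2 * p.2) * regHypSeries (1 + μ + (p.1 + 2 * p.2 : ℕ) + ν)
          (μ + (p.1 + 2 * p.2 : ℕ) - ν) (1 + μ + (p.1 + 2 * p.2 : ℕ)) (-z / 2) *
          gegenbauerHomCoeff μ p.1 p.2 * y ^ p.1 * (2 * z + z ^ 2) ^ p.2 := by
    have h := (hasSum_coeff_two_add_X_pow_mul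
      (hasSum_radialSeries μ ν (p.1 + 2 * p.2) hz) p.2).mul_left
      (B (p.1 + 2 * p.2) * gegenbauerHomCoeff μ p.1 p.2 * z ^ p.2 * y ^ p.1)
    rw [show 2 * z + z ^ 2 = z * (2 + z) by ring, mul_pow]
    refine (tsum_congr fun k => ?_).trans (h.tsum_eq.trans (by ring))
    rw [tripleCoeff, pow_add]
    ring
  have hassoc := (Equiv.prodAssoc ℕ ℕ ℕ).summable_iff.mpr hsum
  have hprod := hassoc.prod
  rw [← (Equiv.prodAssoc ℕ ℕ ℕ).tsum_eq]
  refine hassoc.tsum_prod.trans ?_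
  simp only [Function.comp_apply, Equiv.prodAssoc_apply, hinner] at hprod ⊢
  exact tsum_mul_gegenbauerHom μ y (2 * z + z ^ 2) (fun n => B n *
    regHypSeries (1 + μ + n + ν) (μ + n - ν) (1 + μ + n) (-z / 2)) hprod

theorem tsum_tripleCoeff_eq_tsum_expansionCoeff {μ ν : ℂ} {B : ℕ → ℂ} {z y : ℂ}
    (hsum : Summable fun p : ℕ × ℕ × ℕ =>
      tripleCoeff μ ν B p.1 p.2.1 p.2.2 * z ^ (p.2.1 + p.2.2) * y ^ p.1) :
    ∑' p : ℕ × ℕ × ℕ, tripleCoeff μ ν B p.1 p.2.1 p.2.2 * z ^ (p.2.1 + p.2.2) * y ^ p.1 =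
      ∑' (j : ℕ) (i : ℕ), expansionCoeff μ ν B i j * z ^ i * y ^ j := by
  rw [hsum.tsum_prod]
  refine tsum_congr fun j => (tsum_eq_tsum_sum_antidiagonal (hsum.prod_factor j)).trans ?_
  refine tsum_congr fun i => ?_
  rw [expansionCoeff_eq_sum_antidiagonal, Finset.sum_mul, Finset.sum_mul]
  refine Finset.sum_congr rfl fun p hp => ?_
  rw [Finset.HasAntidiagonal.mem_antidiagonal.mp hp]

theorem tsum_taylorCoeff {c s : ℂ} {φ : ℕ → ℂ} {z y : ℂ}
    (hsum : Summable fun p : ℕ × ℕ => taylorCoeff c s φ p.2 p.1 * z ^ p.2 * y ^ p.1) :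
    ∑' (j : ℕ) (i : ℕ), taylorCoeff c s φ i j * z ^ i * y ^ j =
      ∑' m : ℕ, φ m / m.factorial * (c * z - s * y) ^ m := by
  rw [← hsum.tsum_prod (f := fun p : ℕ × ℕ => taylorCoeff c s φ p.2 p.1 * z ^ p.2 * y ^ p.1),
    tsum_eq_tsum_sum_antidiagonal hsum]
  exact tsum_congr fun m => sum_antidiagonal_taylorCoeff c s φ z y m

theorem eventually_mul_norm_lt_one (a : ℝ) : ∀ᶠ z : ℂ in 𝓝 0, a * ‖z‖ < 1 := by
  have hcont : ContinuousAt (fun z : ℂ => a * ‖z‖) 0 := by fun_prop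
  exact hcont.eventually_lt continuousAt_const (by simp)

theorem addition_germ {μ ν c s : ℂ} (hμ : ∀ n : ℕ, μ + n ≠ 0) (hs : s ^ 2 = c ^ 2 - 1)
    {φ : ℕ → ℂ} {C D : ℝ} (hD : 0 ≤ D) (hbound : ∀ n, ‖φ n‖ ≤ C * D ^ n * n.factorial)
    (hφ : LegendreRecurrence μ ν c φ) :
    ∀ᶠ p : ℂ × ℂ in 𝓝 (0, 0),
      ∑' n : ℕ, additionCoeff μ s φ n *
          regHypSeries (1 + μ + n + ν) (μ + n - ν) (1 + μ + n) (-p.1 / 2) *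
          gegenbauerHom μ p.2 (2 * p.1 + p.1 ^ 2) n =
        ∑' m : ℕ, φ m / m.factorial * (c * p.1 - s * p.2) ^ m := by
  obtain ⟨K, hK⟩ := exists_norm_additionCoeff_le hμ s hbound
  obtain ⟨C', M, hM, htriple⟩ := exists_norm_tripleCoeff_le hμ ν (by positivity) hK
  have hz := ((eventually_mul_norm_lt_one 1).and (eventually_mul_norm_lt_one M)).and
    (eventually_mul_norm_lt_one (2 * D * ‖c‖))
  have hy := (eventually_mul_norm_lt_one M).and (eventually_mul_norm_lt_one (2 * D * ‖s‖))
  filter_upwards [hz.prod_nhds hy]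
  rintro ⟨z, y⟩ ⟨⟨⟨hz, hMz⟩, hcz⟩, hMy, hsy⟩
  rw [one_mul] at hz
  have hsum := summable_tripleCoeff hM htriple hMz hMy
  rw [← tsum_tripleCoeff_eq_tsum_gegenbauerHom hz hsum,
    tsum_tripleCoeff_eq_tsum_expansionCoeff hsum,
    ← tsum_taylorCoeff (summable_taylorCoeff hD hbound hcz hsy)]
  simp only [expansionCoeff_eq_taylorCoeff hμ hs hφ]

end Germ

theorem exists_eventually_norm_Gamma_mul_hypCoeff_mul_pow_le {μ : ℂ} (hμ : ∀ n : ℕ, μ + n ≠ 0)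
    (ν : ℂ) {q : ℝ} (hq₀ : 0 < q) (hq₁ : q < 1) :
    ∃ C : ℝ, ∀ᶠ n : ℕ in atTop, ∀ i : ℕ,
      ‖Gamma (1 + μ + n) * hypCoeff (μ + n - ν) (-ν) (1 + μ + n) i‖ * q ^ i ≤ C := by
  have hshift (n k : ℕ) : 1 + μ + n + k = 1 + μ + (n + k : ℕ) := by push_cast; ring
  have hne (n : ℕ) : 1 + μ + n ≠ 0 := fun h => hμ (n + 1) (by push_cast; linear_combination h)
  obtain ⟨p, hqp, hp⟩ := exists_between hq₁
  obtain ⟨C, -, hC⟩ := exists_norm_hypCoeff_mul_pow_le (-ν) 1 1 (hq₀.trans hqp).le hp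
  obtain ⟨N, hN⟩ := eventually_atTop.mp
    (eventually_norm_add_le_mul_norm (μ - ν) hne ((one_lt_div hq₀).mpr hqp))
  refine ⟨C, eventually_atTop.mpr ⟨N, fun n hn i => ?_⟩⟩
  have hne' (k : ℕ) : 1 + μ + n + k ≠ 0 := hshift n k ▸ hne _
  have hquot : ‖poch (μ + n - ν) i / poch (1 + μ + n) i‖ ≤ (p / q) ^ i := by
    rw [norm_div, div_le_iff₀ (norm_pos_iff.mpr (poch_ne_zero hne' i))]
    refine norm_poch_le_pow_mul_norm_poch (fun k => ?_) i
    rw [hshift, show μ + n - ν + k = μ - ν + (n + k : ℕ) by push_cast; ring]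
    exact hN _ (Nat.le_add_right_of_le hn)
  rw [Gamma_mul_hypCoeff hne', ← hypCoeff_one_one, norm_mul]
  calc _ ≤ (p / q) ^ i * ‖hypCoeff (-ν) 1 1 i‖ * q ^ i := by gcongr
    _ = ‖hypCoeff (-ν) 1 1 i‖ * p ^ i := by
      rw [div_pow]
      field_simp
    _ ≤ C := hC i

theorem exists_norm_Gamma_mul_hypCoeff_mul_pow_le {μ : ℂ} (hμ : ∀ n : ℕ, μ + n ≠ 0) (ν : ℂ)
    {q : ℝ} (hq₀ : 0 < q) (hq₁ : q < 1) :
    ∃ C : ℝ, ∀ n i : ℕ,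
      ‖Gamma (1 + μ + n) * hypCoeff (μ + n - ν) (-ν) (1 + μ + n) i‖ * q ^ i ≤ C := by
  obtain ⟨C, hC⟩ := exists_eventually_norm_Gamma_mul_hypCoeff_mul_pow_le hμ ν hq₀ hq₁
  obtain ⟨N, hN⟩ := eventually_atTop.mp hC
  have hsmall (n : ℕ) : ∃ C : ℝ, ∀ i : ℕ,
      ‖Gamma (1 + μ + n) * hypCoeff (μ + n - ν) (-ν) (1 + μ + n) i‖ * q ^ i ≤ C := by
    obtain ⟨C, -, hC⟩ := exists_norm_hypCoeff_mul_pow_le (μ + n - ν) (-ν) (1 + μ + n) hq₀.le hq₁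
    refine ⟨‖Gamma (1 + μ + n)‖ * C, fun i => ?_⟩
    rw [norm_mul, mul_assoc]
    exact mul_le_mul_of_nonneg_left (hC i) (norm_nonneg _)
  choose B hB using hsmall
  obtain ⟨M, hM⟩ := ((range N).image B).exists_le
  refine ⟨max M C, fun n i => ?_⟩
  rcases lt_or_ge n N with hn | hn
  · exact (hB n i).trans
      ((hM _ (Finset.mem_image_of_mem B (Finset.mem_range.mpr hn))).trans (le_max_left M C))
  · exact (hN n hn i).trans (le_max_right M C)

theorem exists_norm_Gamma_mul_regHypSeries_le {μ : ℂ} (hμ : ∀ n : ℕ, μ + n ≠ 0) (ν : ℂ) {q : ℝ}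
    (hq₀ : 0 ≤ q) (hq₁ : q < 1) :
    ∃ C : ℝ, 0 ≤ C ∧ ∀ (n : ℕ) (w : ℂ), ‖w‖ ≤ q →
      ‖Gamma (1 + μ + n) * regHypSeries (μ + n - ν) (-ν) (1 + μ + n) w‖ ≤ C := by
  obtain ⟨p, hqp, hp⟩ := exists_between hq₁
  have hp₀ : 0 < p := hq₀.trans_lt hqp
  obtain ⟨C, hC⟩ := exists_norm_Gamma_mul_hypCoeff_mul_pow_le hμ ν hp₀ hp
  have hgeom : Summable fun i : ℕ => C * (q / p) ^ i :=
    (summable_geometric_of_lt_one (by positivity) ((div_lt_one hp₀).mpr hqp)).mul_left C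
  have hbound (n : ℕ) (w : ℂ) (hw : ‖w‖ ≤ q) :
      ‖Gamma (1 + μ + n) * regHypSeries (μ + n - ν) (-ν) (1 + μ + n) w‖ ≤
        ∑' i, C * (q / p) ^ i := by
    rw [regHypSeries_eq_tsum, ← tsum_mul_left]
    refine tsum_of_norm_bounded hgeom.hasSum fun i => ?_
    rw [← mul_assoc, norm_mul, norm_pow]
    have hcoeff := (le_div_iff₀ (by positivity)).mpr (hC n i)
    calc _ ≤ C / p ^ i * q ^ i :=
          mul_le_mul hcoeff (by gcongr) (by positivity) ((norm_nonneg _).trans hcoeff)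
      _ = C * (q / p) ^ i := by rw [div_pow, div_mul_comm, mul_comm]
  exact ⟨_, (norm_nonneg _).trans (hbound 0 0 (by simpa using hq₀)), hbound⟩

/-! ### Sequences of successive derivatives -/

section DerivSequence

variable {U : Set ℂ} {F : ℕ → ℂ → ℂ} {c : ℂ} {R : ℝ}

theorem iteratedDeriv_of_hasDerivAt_succ (hU : IsOpen U)
    (hF : ∀ n, ∀ z ∈ U, HasDerivAt (F n) (F (n + 1) z) z) (n : ℕ) {z : ℂ} (hz : z ∈ U) :
    iteratedDeriv n (F 0) z = F n z := by
  induction n generalizing z with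
  | zero => rw [iteratedDeriv_zero]
  | succ n ih =>
    have heventually : iteratedDeriv n (F 0) =ᶠ[𝓝 z] F n := by
      filter_upwards [hU.mem_nhds hz] with w hw using ih hw
    rw [iteratedDeriv_succ, heventually.deriv_eq, (hF n z hz).deriv]

theorem differentiableOn_of_hasDerivAt_succ
    (hF : ∀ n, ∀ z ∈ U, HasDerivAt (F n) (F (n + 1) z) z) (n : ℕ) : DifferentiableOn ℂ (F n) U :=
  fun z hz => (hF n z hz).differentiableAt.differentiableWithinAt

theorem exists_norm_le_of_hasDerivAt_succ (hU : IsOpen U)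
    (hF : ∀ n, ∀ z ∈ U, HasDerivAt (F n) (F (n + 1) z) z) (hR : 0 < R)
    (hball : Metric.closedBall c R ⊆ U) :
    ∃ C : ℝ, 0 ≤ C ∧ ∀ n, ‖F n c‖ ≤ C * R⁻¹ ^ n * n.factorial := by
  have hdiff := (differentiableOn_of_hasDerivAt_succ hF 0).mono hball
  obtain ⟨C, hC⟩ := (isCompact_closedBall c R).exists_bound_of_continuousOn hdiff.continuousOn
  have hc := Metric.mem_closedBall_self (x := c) hR.le
  refine ⟨C, (norm_nonneg _).trans (hC c hc), fun n => ?_⟩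
  rw [← iteratedDeriv_of_hasDerivAt_succ hU hF n (hball hc)]
  refine (Complex.norm_iteratedDeriv_le_of_forall_mem_sphere_norm_le n hR ?_
    fun z hz => hC z (Metric.sphere_subset_closedBall hz)).trans (le_of_eq ?_)
  · exact (hdiff.mono (closure_ball c hR.ne').subset).diffContOnCl
  · rw [inv_pow]
    ring

theorem tsum_taylor_of_hasDerivAt_succ (hU : IsOpen U)
    (hF : ∀ n, ∀ z ∈ U, HasDerivAt (F n) (F (n + 1) z) z) (hball : Metric.ball c R ⊆ U) {h : ℂ}
    (hh : ‖h‖ < R) : ∑' m : ℕ, F m c / m.factorial * h ^ m = F 0 (c + h) := by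
  have hc : c ∈ U := hball (Metric.mem_ball_self ((norm_nonneg h).trans_lt hh))
  have hsum := Complex.hasSum_taylorSeries_on_ball (z := c + h)
    ((differentiableOn_of_hasDerivAt_succ hF 0).mono hball) (by simpa [dist_eq_norm] using hh)
  rw [← hsum.tsum_eq]
  refine tsum_congr fun m => ?_
  rw [iteratedDeriv_of_hasDerivAt_succ hU hF m hc, add_sub_cancel_left, smul_eq_mul, smul_eq_mul]
  ring

end DerivSequence

/-! ### Analytic continuation of the addition theorem -/

/-- The `n`-th term of the addition theorem as a function of `w = tanh (r / 2)`, up to the factor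
`(1 - w ^ 2) ^ (μ - ν)`, which does not depend on `n`. -/
noncomputable def additionTerm (μ ν s : ℂ) (φ : ℕ → ℂ) (t : ℂ) (n : ℕ) (w : ℂ) : ℂ :=
  additionCoeff μ s φ n * gegenbauerC n μ t * (2 * w) ^ n *
    regHypSeries (μ + n - ν) (-ν) (1 + μ + n) (w ^ 2)

theorem additionTerm_eq (μ ν s : ℂ) (φ : ℕ → ℂ) (t : ℂ) (n : ℕ) (w : ℂ) :
    additionTerm μ ν s φ t n w =
      Gamma (1 + μ + n) * regHypSeries (μ + n - ν) (-ν) (1 + μ + n) (w ^ 2) *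
        ((-(s * w)) ^ n * (φ n / n.factorial) * (n.factorial / poch μ n) *
          gegenbauerC n μ t) := by
  have hfac := factorial_ne_zero n
  rw [additionTerm, additionCoeff, mul_pow, neg_mul_eq_neg_mul, mul_pow]
  field_simp

theorem differentiableOn_additionTerm (μ ν s : ℂ) (φ : ℕ → ℂ) (t : ℂ) (n : ℕ) :
    DifferentiableOn ℂ (additionTerm μ ν s φ t n) (Metric.ball 0 1) := by
  refine DifferentiableOn.mul (by fun_prop) ((differentiableOn_regHypSeries _ _ _).comp
    (by fun_prop) fun w hw => ?_)
  rw [mem_ball_zero_iff] at hw ⊢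
  exact norm_sq_lt_one hw

section Convergence

variable {μ s : ℂ} {φ : ℕ → ℂ} {R : ℝ}

theorem exists_summable_norm_additionTerm_le (hμ : ∀ n : ℕ, μ + n ≠ 0)
    (hμ' : ∀ n : ℕ, μ + 1 / 2 + n ≠ 0) (ν : ℂ) (hR : 0 < R)
    (hφ : ∀ D, 0 < D → D < R → ∃ C : ℝ, 0 ≤ C ∧ ∀ n, ‖φ n‖ ≤ C * D⁻¹ ^ n * n.factorial)
    (γ : ℝ) {τ : ℝ} (hτ₀ : 0 ≤ τ) (hτ₁ : τ < 1) (hsτ : ‖s‖ * τ < R) :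
    ∃ M : ℕ → ℝ, Summable M ∧ ∀ (n : ℕ) (w : ℂ), ‖w‖ ≤ τ →
      ‖additionTerm μ ν s φ (Real.cos γ) n w‖ ≤ M n := by
  set θ := ‖s‖ * τ / R with hθ
  have hθ₀ : 0 ≤ θ := by positivity
  have hθ₁ : θ < 1 := (div_lt_one hR).mpr hsτ
  obtain ⟨q, hq₀, hq₁, hq⟩ : ∃ q : ℝ, 0 < q ∧ q < 1 ∧ θ < q ^ 3 :=
    ⟨(3 + θ) / 4, by linarith, by linarith, by
      nlinarith [one_add_mul_le_pow (a := (θ - 1) / 4) (by linarith) 3]⟩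
  obtain ⟨C₁, hC₁, hφ⟩ := hφ (q * R) (by positivity) (mul_lt_of_lt_one_left hR hq₁)
  obtain ⟨C₂, hC₂, hpoch⟩ := exists_norm_factorial_div_poch_mul_pow_le hμ hq₀.le hq₁
  obtain ⟨C₃, hC₃, hgegenbauer⟩ := exists_norm_gegenbauerC_mul_pow_le hμ' γ hq₀ hq₁
  obtain ⟨C₄, hC₄, hradial⟩ := exists_norm_Gamma_mul_regHypSeries_le hμ ν (q := τ ^ 2)
    (by positivity) (by nlinarith)
  refine ⟨fun n => C₄ * (C₁ * C₂ * C₃ * (θ / q ^ 3) ^ n), ((summable_geometric_of_lt_one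
    (by positivity) ((div_lt_one (by positivity)).mpr hq)).mul_left _).mul_left _,
    fun n w hw => ?_⟩
  have hφn : ‖φ n / n.factorial‖ ≤ C₁ * (q * R)⁻¹ ^ n := by
    rw [norm_div, Complex.norm_natCast, div_le_iff₀ (mod_cast n.factorial_pos)]
    exact hφ n
  rw [additionTerm_eq, norm_mul]
  refine mul_le_mul (hradial n _ (by rw [norm_pow]; gcongr)) ?_ (norm_nonneg _) hC₄
  rw [norm_mul, norm_mul, norm_mul, norm_pow, norm_neg, norm_mul s]
  calc (‖s‖ * ‖w‖) ^ n * ‖φ n / n.factorial‖ * ‖n.factorial / poch μ n‖ *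
        ‖gegenbauerC n μ (Real.cos γ)‖
      ≤ (‖s‖ * τ) ^ n * (C₁ * (q * R)⁻¹ ^ n) * (C₂ / q ^ n) * (C₃ / q ^ n) := by
        gcongr
        · exact (le_div_iff₀ (by positivity)).mpr (hpoch n)
        · exact (le_div_iff₀ (by positivity)).mpr (hgegenbauer n)
    _ = C₁ * C₂ * C₃ * ((‖s‖ * τ) ^ n * (q * R)⁻¹ ^ n / q ^ n / q ^ n) := by ring
    _ = C₁ * C₂ * C₃ * (θ / q ^ 3) ^ n := by
        rw [← mul_pow, ← div_pow, ← div_pow, hθ]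
        congr 2
        field_simp

theorem summable_norm_additionTerm (hμ : ∀ n : ℕ, μ + n ≠ 0)
    (hμ' : ∀ n : ℕ, μ + 1 / 2 + n ≠ 0) (ν : ℂ) (hR : 0 < R)
    (hφ : ∀ D, 0 < D → D < R → ∃ C : ℝ, 0 ≤ C ∧ ∀ n, ‖φ n‖ ≤ C * D⁻¹ ^ n * n.factorial)
    (γ : ℝ) {w : ℂ} (hw : ‖w‖ < 1) (hsw : ‖s‖ * ‖w‖ < R) :
    Summable fun n => ‖additionTerm μ ν s φ (Real.cos γ) n w‖ := by
  obtain ⟨M, hM, hbound⟩ := exists_summable_norm_additionTerm_le hμ hμ' ν hR hφ γ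
    (norm_nonneg w) hw hsw
  exact hM.of_nonneg_of_le (fun n => norm_nonneg _) fun n => hbound n w le_rfl

theorem differentiableAt_tsum_additionTerm (hμ : ∀ n : ℕ, μ + n ≠ 0)
    (hμ' : ∀ n : ℕ, μ + 1 / 2 + n ≠ 0) (ν : ℂ) (hR : 0 < R)
    (hφ : ∀ D, 0 < D → D < R → ∃ C : ℝ, 0 ≤ C ∧ ∀ n, ‖φ n‖ ≤ C * D⁻¹ ^ n * n.factorial)
    (γ : ℝ) {w : ℂ} (hw : ‖w‖ < 1) (hsw : ‖s‖ * ‖w‖ < R) :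
    DifferentiableAt ℂ (fun w => ∑' n, additionTerm μ ν s φ (Real.cos γ) n w) w := by
  have hnear : ∀ᶠ τ in 𝓝[>] ‖w‖, τ < 1 ∧ ‖s‖ * τ < R :=
    ((eventually_lt_nhds hw).and (ContinuousAt.eventually_lt (by fun_prop)
      continuousAt_const hsw)).filter_mono nhdsWithin_le_nhds
  obtain ⟨τ, ⟨hτ₁, hsτ⟩, hwτ⟩ := (hnear.and self_mem_nhdsWithin).exists
  obtain ⟨M, hM, hbound⟩ := exists_summable_norm_additionTerm_le hμ hμ' ν hR hφ γ
    ((norm_nonneg w).trans hwτ.le) hτ₁ hsτ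
  have hdiff := Complex.differentiableOn_tsum_of_summable_norm hM (U := Metric.ball 0 τ)
    (fun n => (differentiableOn_additionTerm μ ν s φ (Real.cos γ) n).mono
      (Metric.ball_subset_ball hτ₁.le)) Metric.isOpen_ball
    fun n w hw => hbound n w (mem_ball_zero_iff.mp hw).le
  exact hdiff.differentiableAt (Metric.isOpen_ball.mem_nhds (mem_ball_zero_iff.mpr hwτ))

end Convergence

/-- The relations between the functions `F n z = (z ^ 2 - 1) ^ (-(μ + n) / 2) * P_ν^(μ + n) (z)` on
the half-plane `1 < Re z`; the functions of the second kind satisfy them as well. -/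
structure IsLegendreLadder (μ ν : ℂ) (F : ℕ → ℂ → ℂ) : Prop where
  hasDerivAt : ∀ n, ∀ z ∈ {z : ℂ | 1 < z.re}, HasDerivAt (F n) (F (n + 1) z) z
  recurrence : ∀ z ∈ {z : ℂ | 1 < z.re}, LegendreRecurrence μ ν z (fun n => F n z)

/-- The value `cosh r * cosh r' - sinh r * sinh r' * cos γ` for `c = cosh r'`, `s = sinh r'` and
`t = cos γ`, as a function of `w = tanh (r / 2)`. -/
noncomputable def coshRho (c s t w : ℂ) : ℂ :=
  c + (c * (2 * w ^ 2 / (1 - w ^ 2)) - s * (2 * w / (1 - w ^ 2) * t))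

theorem isOpen_one_lt_re : IsOpen {z : ℂ | 1 < z.re} :=
  isOpen_lt continuous_const Complex.continuous_re

theorem ball_subset_one_lt_re (c : ℂ) : Metric.ball c (c.re - 1) ⊆ {z : ℂ | 1 < z.re} := by
  intro z hz
  have hre := (Complex.abs_re_le_norm (z - c)).trans_lt (mem_ball_iff_norm.mp hz)
  rw [Complex.sub_re, abs_lt] at hre
  exact show 1 < z.re by linarith [hre.1]

theorem one_sub_sq_ne_zero {w : ℂ} (hw : ‖w‖ < 1) : 1 - w ^ 2 ≠ 0 := by
  refine sub_ne_zero.mpr fun h => (norm_sq_lt_one hw).ne ?_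
  rw [← h, norm_one]

theorem regHypSeries_radial (μ ν : ℂ) (n : ℕ) {w : ℂ} (hw : ‖w‖ < 1)
    (hw' : ‖w ^ 2 / (1 - w ^ 2)‖ < 1 / 8) :
    regHypSeries (1 + μ + n + ν) (μ + n - ν) (1 + μ + n) (-(2 * w ^ 2 / (1 - w ^ 2)) / 2) =
      (1 - w ^ 2) ^ (μ - ν) * (1 - w ^ 2) ^ n *
        regHypSeries (μ + n - ν) (-ν) (1 + μ + n) (w ^ 2) := by
  rw [regHypSeries_symm, show -(2 * w ^ 2 / (1 - w ^ 2)) / 2 = -(w ^ 2 / (1 - w ^ 2)) by ring,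
    regHypSeries_neg_div_one_sub _ _ _ (norm_sq_lt_one hw) hw', add_sub_right_comm,
    Complex.cpow_add _ _ (one_sub_sq_ne_zero hw), Complex.cpow_natCast, sub_add_cancel_left]

section RealParameters

variable {c s u : ℝ}

theorem abs_lt_one_of_mul_abs_lt (hs : s ^ 2 = c ^ 2 - 1) (hs₀ : 0 < s) (hu : s * |u| < c - 1) :
    |u| < 1 := by
  have hc : 0 < c - 1 := (by positivity : 0 ≤ s * |u|).trans_lt hu
  exact lt_of_mul_lt_mul_left (by nlinarith) hs₀.le

theorem one_lt_coshRho (hs : s ^ 2 = c ^ 2 - 1) (hs₀ : 0 < s) {t : ℝ} (ht : |t| ≤ 1)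
    (hu : s * |u| < c - 1) : 1 < (coshRho c s t u).re := by
  have hc : 0 < c - 1 := (by positivity : 0 ≤ s * |u|).trans_lt hu
  have hu₁ : 0 < 1 - u ^ 2 :=
    sub_pos.mpr ((sq_lt_one_iff_abs_lt_one u).mpr (abs_lt_one_of_mul_abs_lt hs hs₀ hu))
  have hcast : coshRho c s t u =
      ((1 + ((c - 1) + (c + 1) * u ^ 2 - 2 * s * (u * t)) / (1 - u ^ 2) : ℝ) : ℂ) := by
    have hne : (1 - u ^ 2 : ℂ) ≠ 0 := mod_cast hu₁.ne'
    rw [coshRho]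
    push_cast
    field_simp
    ring
  have hut : u * t ≤ |u| :=
    (le_abs_self _).trans (abs_mul u t ▸ mul_le_of_le_one_right (abs_nonneg u) ht)
  have hsquare : (c - 1) * ((c - 1) + (c + 1) * u ^ 2 - 2 * s * |u|) = (c - 1 - s * |u|) ^ 2 := by
    linear_combination (|u| ^ 2 * -1) * hs - (c ^ 2 - 1) * sq_abs u
  have hpos : 0 < (c - 1) + (c + 1) * u ^ 2 - 2 * s * |u| :=
    pos_of_mul_pos_right (hsquare ▸ pow_pos (sub_pos.mpr hu) 2) hc.le
  have hnum : 0 < (c - 1) + (c + 1) * u ^ 2 - 2 * s * (u * t) :=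
    hpos.trans_le (by gcongr)
  rw [hcast, Complex.ofReal_re]
  exact lt_add_of_pos_right 1 (div_pos hnum hu₁)

end RealParameters

theorem analyticAt_comp_ofReal {g : ℂ → ℂ} {x : ℝ} (hg : AnalyticAt ℂ g x) :
    AnalyticAt ℝ (fun x : ℝ => g x) x :=
  (hg.restrictScalars (𝕜 := ℝ)).comp (f := fun x : ℝ => (x : ℂ)) (Complex.ofRealCLM.analyticAt x)

namespace IsLegendreLadder

variable {μ ν : ℂ} {F : ℕ → ℂ → ℂ}

theorem exists_norm_le (hF : IsLegendreLadder μ ν F) {c : ℂ} {D : ℝ} (hD : 0 < D)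
    (hDc : D < c.re - 1) : ∃ C : ℝ, 0 ≤ C ∧ ∀ n, ‖F n c‖ ≤ C * D⁻¹ ^ n * n.factorial :=
  exists_norm_le_of_hasDerivAt_succ isOpen_one_lt_re hF.hasDerivAt hD
    ((Metric.closedBall_subset_ball hDc).trans (ball_subset_one_lt_re c))

theorem eventually_apply_coshRho (hF : IsLegendreLadder μ ν F) (hμ : ∀ n : ℕ, μ + n ≠ 0)
    (hμ' : ∀ n : ℕ, μ + 1 / 2 + n ≠ 0) {c s : ℂ} (hc : 1 < c.re) (hs : s ^ 2 = c ^ 2 - 1)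
    (t : ℂ) : ∀ᶠ w : ℂ in 𝓝 0, F 0 (coshRho c s t w) =
      (1 - w ^ 2) ^ (μ - ν) * ∑' n, additionTerm μ ν s (fun n => F n c) t n w := by
  obtain ⟨C, -, hbound⟩ := hF.exists_norm_le (c := c) (D := (c.re - 1) / 2) (by linarith)
    (by linarith)
  have hcont : ContinuousAt (fun w : ℂ => (2 * w ^ 2 / (1 - w ^ 2), 2 * w / (1 - w ^ 2) * t)) 0 :=
    (ContinuousAt.div (by fun_prop) (by fun_prop) (by simp)).prodMk
      ((ContinuousAt.div (by fun_prop) (by fun_prop) (by simp)).mul_const t)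
  have htendsto : Tendsto (fun w : ℂ => (2 * w ^ 2 / (1 - w ^ 2), 2 * w / (1 - w ^ 2) * t))
      (𝓝 0) (𝓝 (0, 0)) := by simpa [ContinuousAt] using hcont
  have hball : ∀ᶠ p : ℂ × ℂ in 𝓝 (0, 0), ‖c * p.1 - s * p.2‖ < c.re - 1 :=
    ContinuousAt.eventually_lt (by fun_prop) continuousAt_const (by simpa using hc)
  have hpfaff : ∀ᶠ w : ℂ in 𝓝 0, ‖w ^ 2 / (1 - w ^ 2)‖ < 1 / 8 :=
    (ContinuousAt.div (by fun_prop) (by fun_prop) (by simp)).norm.eventually_lt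
      continuousAt_const (by simp)
  filter_upwards [htendsto.eventually (addition_germ hμ hs (by
      have hc₀ := sub_pos.mpr hc
      positivity) hbound (hF.recurrence c hc)),
    htendsto.eventually hball, hpfaff, Metric.ball_mem_nhds 0 one_pos] with w hgerm hw hpfaff hw₁
  rw [mem_ball_zero_iff] at hw₁
  have hne := one_sub_sq_ne_zero hw₁
  rw [coshRho, ← tsum_taylor_of_hasDerivAt_succ isOpen_one_lt_re hF.hasDerivAt
    (ball_subset_one_lt_re c) hw, ← hgerm, ← tsum_mul_left]
  refine tsum_congr fun n => ?_
  have hsq : 2 * (2 * w ^ 2 / (1 - w ^ 2)) + (2 * w ^ 2 / (1 - w ^ 2)) ^ 2 =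
      (2 * w / (1 - w ^ 2)) ^ 2 := by
    field_simp
    ring
  rw [hsq, gegenbauerHom_mul_sq hμ', regHypSeries_radial μ ν n hw₁ hpfaff, additionTerm, div_pow]
  field_simp

theorem analyticAt_apply_coshRho (hF : IsLegendreLadder μ ν F) {c s t w : ℂ} (hw : ‖w‖ < 1)
    (hre : 1 < (coshRho c s t w).re) : AnalyticAt ℂ (fun w => F 0 (coshRho c s t w)) w := by
  have hne := one_sub_sq_ne_zero hw
  have hcoshRho : AnalyticAt ℂ (coshRho c s t) w := by
    unfold coshRho
    fun_prop (disch := assumption)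
  exact AnalyticAt.comp ((differentiableOn_of_hasDerivAt_succ hF.hasDerivAt 0).analyticAt
    (isOpen_one_lt_re.mem_nhds hre)) hcoshRho

theorem analyticAt_mul_tsum_additionTerm (hF : IsLegendreLadder μ ν F) (hμ : ∀ n : ℕ, μ + n ≠ 0)
    (hμ' : ∀ n : ℕ, μ + 1 / 2 + n ≠ 0) (γ : ℝ) {c s w : ℂ} (hw : ‖w‖ < 1)
    (hsw : ‖s‖ * ‖w‖ < c.re - 1) :
    AnalyticAt ℂ (fun w => (1 - w ^ 2) ^ (μ - ν) *
      ∑' n, additionTerm μ ν s (fun n => F n c) (Real.cos γ) n w) w := by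
  have hc : 0 < c.re - 1 := (by positivity : 0 ≤ ‖s‖ * ‖w‖).trans_lt hsw
  have hnear : ∀ᶠ w' : ℂ in 𝓝 w, ‖w'‖ < 1 ∧ ‖s‖ * ‖w'‖ < c.re - 1 :=
    (ContinuousAt.eventually_lt (by fun_prop) continuousAt_const hw).and
      (ContinuousAt.eventually_lt (by fun_prop) continuousAt_const hsw)
  refine Complex.analyticAt_iff_eventually_differentiableAt.mpr (hnear.mono ?_)
  rintro w' ⟨hw', hsw'⟩
  refine DifferentiableAt.mul (DifferentiableAt.cpow_const (by fun_prop) (Or.inl ?_))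
    (differentiableAt_tsum_additionTerm hμ hμ' ν hc (fun D => hF.exists_norm_le) γ hw' hsw')
  have hre := (Complex.re_le_norm (w' ^ 2)).trans_lt (norm_sq_lt_one hw')
  rwa [Complex.sub_re, Complex.one_re, sub_pos]

theorem apply_coshRho (hF : IsLegendreLadder μ ν F) (hμ : ∀ n : ℕ, μ + n ≠ 0)
    (hμ' : ∀ n : ℕ, μ + 1 / 2 + n ≠ 0) {c s : ℝ} (hs : s ^ 2 = c ^ 2 - 1) (hs₀ : 0 < s) (γ : ℝ)
    {u : ℝ} (hu : s * |u| < c - 1) :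
    F 0 (coshRho c s (Real.cos γ) u) = (1 - (u : ℂ) ^ 2) ^ (μ - ν) *
      ∑' n, additionTerm μ ν s (fun n => F n c) (Real.cos γ) n u := by
  have hc : 0 < c - 1 := (by positivity : 0 ≤ s * |u|).trans_lt hu
  have hball {x : ℝ} : x ∈ Metric.ball (0 : ℝ) ((c - 1) / s) ↔ s * |x| < c - 1 := by
    rw [mem_ball_zero_iff, Real.norm_eq_abs, lt_div_iff₀' hs₀]
  have hnorm {x : ℝ} (hx : s * |x| < c - 1) : ‖(x : ℂ)‖ < 1 := by
    rw [Complex.norm_real]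
    exact abs_lt_one_of_mul_abs_lt hs hs₀ hx
  have hleft : AnalyticOnNhd ℝ (fun x : ℝ => F 0 (coshRho c s (Real.cos γ) x))
      (Metric.ball 0 ((c - 1) / s)) := fun x hx =>
    analyticAt_comp_ofReal (hF.analyticAt_apply_coshRho (hnorm (hball.mp hx))
      (one_lt_coshRho hs hs₀ (Real.abs_cos_le_one γ) (hball.mp hx)))
  have hright : AnalyticOnNhd ℝ (fun x : ℝ => (1 - (x : ℂ) ^ 2) ^ (μ - ν) *
      ∑' n, additionTerm μ ν s (fun n => F n c) (Real.cos γ) n x)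
      (Metric.ball 0 ((c - 1) / s)) := fun x hx =>
    analyticAt_comp_ofReal (hF.analyticAt_mul_tsum_additionTerm hμ hμ' γ (hnorm (hball.mp hx)) (by
      simpa [abs_of_pos hs₀] using hball.mp hx))
  have hgerm := hF.eventually_apply_coshRho hμ hμ' (c := c) (s := s)
    (by simpa using sub_pos.mp hc) (by exact_mod_cast hs) (Real.cos γ)
  exact hleft.eqOn_of_preconnected_of_eventuallyEq hright
    (convex_ball _ _).isPreconnected (Metric.mem_ball_self (by positivity))
    (Complex.continuous_ofReal.tendsto' 0 0 Complex.ofReal_zero |>.eventually hgerm)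
    (hball.mpr hu)

end IsLegendreLadder

/-! ### The functions of the first kind -/

theorem hypCoeff_eq_mul_hypCoeff_add_one (a b c : ℂ) (n : ℕ) :
    hypCoeff a b c n = (c + n) * hypCoeff a b (c + 1) n := by
  rw [hypCoeff, hypCoeff, inv_Gamma_eq_mul (c + n), add_right_comm]
  ring

theorem hasSum_hypCoeff_succ (a b c : ℂ) {w : ℂ} (hw : ‖w‖ < 1) :
    HasSum (fun n => hypCoeff a b c (n + 1) * w ^ (n + 1))
      (regHypSeries a b c w - hypCoeff a b c 0) := by
  simpa using (hasSum_nat_add_iff' 1).mpr (hasSum_regHypSeries a b c hw)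

theorem mul_deriv_regHypSeries_add (a b c : ℂ) {w : ℂ} (hw : ‖w‖ < 1) :
    w * deriv (regHypSeries a b (c + 1)) w + c * regHypSeries a b (c + 1) w =
      regHypSeries a b c w := by
  refine ((hasSum_mul_deriv_regHypSeries a b (c + 1) hw).add
    ((hasSum_regHypSeries a b (c + 1) hw).mul_left c)).unique
    ((hasSum_regHypSeries a b c hw).congr_fun fun n => ?_)
  rw [hypCoeff_eq_mul_hypCoeff_add_one a b c]
  ring

theorem regHypSeries_contiguous (a b c : ℂ) {w : ℂ} (hw : ‖w‖ < 1) :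
    (w - 1) * regHypSeries a b c w
      + (c - (2 * c + 1 - a - b) * w) * regHypSeries a b (c + 1) w
      + (c + 1 - a) * (c + 1 - b) * w * regHypSeries a b (c + 2) w = 0 := by
  have hsum₀ := ((hasSum_regHypSeries a b c hw).mul_left w).sub (hasSum_hypCoeff_succ a b c hw)
  have hsum₁ := ((hasSum_hypCoeff_succ a b (c + 1) hw).mul_left c).sub
    ((hasSum_regHypSeries a b (c + 1) hw).mul_left ((2 * c + 1 - a - b) * w))
  have hsum₂ := (hasSum_regHypSeries a b (c + 2) hw).mul_left ((c + 1 - a) * (c + 1 - b) * w)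
  have hcoeff₀ := hypCoeff_eq_mul_hypCoeff_add_one a b c
  have hcoeff₁ (n : ℕ) : hypCoeff a b (c + 1) n = (c + 1 + n) * hypCoeff a b (c + 2) n := by
    rw [hypCoeff_eq_mul_hypCoeff_add_one, add_assoc c 1 1, one_add_one_eq_two]
  have hzero := ((hsum₀.add hsum₁).add hsum₂).unique
    ((hasSum_zero (α := ℂ) (β := ℕ)).congr_fun fun n => by
      simp only [hcoeff₀, hcoeff₁]
      push_cast
      linear_combination -w ^ (n + 1) * hypCoeff_succ a b (c + 2) n)
  rw [hcoeff₀ 0, Nat.cast_zero, add_zero] at hzero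
  linear_combination hzero

theorem eq_zero_of_eventually_eq_zero_of_re_lt_half {f : ℂ → ℂ}
    (hf : DifferentiableOn ℂ f {w : ℂ | w.re < 1 / 2}) (hf₀ : ∀ᶠ w in 𝓝 0, f w = 0)
    {w : ℂ} (hw : w.re < 1 / 2) : f w = 0 :=
  (hf.analyticOnNhd isOpen_re_lt_half).eqOn_zero_of_preconnected_of_eventuallyEq_zero
    convex_re_lt_half.isPreconnected (z₀ := 0) (by simp) hf₀ hw

theorem mul_deriv_pfaffHyp_add (a b c : ℂ) {w : ℂ} (hw : w.re < 1 / 2) :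
    w * deriv (pfaffHyp a b (c + 1)) w + c * pfaffHyp a b (c + 1) w = pfaffHyp a b c w := by
  have hdiff := differentiableOn_pfaffHyp a b
  have hderiv := (hdiff (c + 1)).deriv isOpen_re_lt_half
  refine sub_eq_zero.mp (eq_zero_of_eventually_eq_zero_of_re_lt_half (f := fun w =>
    w * deriv (pfaffHyp a b (c + 1)) w + c * pfaffHyp a b (c + 1) w - pfaffHyp a b c w) ?_ ?_ hw)
  · exact ((differentiableOn_id.mul hderiv).add ((hdiff (c + 1)).const_mul _)).sub (hdiff c)
  · have hgerm := regHypSeries_eventuallyEq_pfaffHyp a b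
    filter_upwards [hgerm (c + 1), (hgerm (c + 1)).deriv, hgerm c,
      Metric.ball_mem_nhds (0 : ℂ) one_pos] with w hval hderiv_val hval' hmem
    rw [← hval, ← hderiv_val, ← hval',
      mul_deriv_regHypSeries_add a b c (mem_ball_zero_iff.mp hmem), sub_self]

theorem pfaffHyp_contiguous (a b c : ℂ) {w : ℂ} (hw : w.re < 1 / 2) :
    (w - 1) * pfaffHyp a b c w
      + (c - (2 * c + 1 - a - b) * w) * pfaffHyp a b (c + 1) w
      + (c + 1 - a) * (c + 1 - b) * w * pfaffHyp a b (c + 2) w = 0 := by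
  refine eq_zero_of_eventually_eq_zero_of_re_lt_half (f := fun w => (w - 1) * pfaffHyp a b c w
    + (c - (2 * c + 1 - a - b) * w) * pfaffHyp a b (c + 1) w
    + (c + 1 - a) * (c + 1 - b) * w * pfaffHyp a b (c + 2) w) ?_ ?_ hw
  · have hdiff₀ := differentiableOn_pfaffHyp a b c
    have hdiff₁ := differentiableOn_pfaffHyp a b (c + 1)
    have hdiff₂ := differentiableOn_pfaffHyp a b (c + 2)
    fun_prop
  · have hgerm := regHypSeries_eventuallyEq_pfaffHyp a b
    filter_upwards [hgerm c, hgerm (c + 1), hgerm (c + 2), Metric.ball_mem_nhds (0 : ℂ) one_pos]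
      with w hval₀ hval₁ hval₂ hmem
    rw [← hval₀, ← hval₁, ← hval₂]
    exact regHypSeries_contiguous a b c (mem_ball_zero_iff.mp hmem)

/-- The continuation of `(x ^ 2 - 1) ^ (-M / 2) * P_ν^M (x)` to the half-plane `1 < Re z`: the power
of `x + 1` cancels, and only a power of `z - 1` is left. -/
noncomputable def reducedP (ν M z : ℂ) : ℂ :=
  (z - 1) ^ (-M) * pfaffHyp (-ν) (ν + 1) (1 - M) ((1 - z) / 2)

theorem sub_one_mem_slitPlane {z : ℂ} (hz : 1 < z.re) : z - 1 ∈ Complex.slitPlane :=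
  Or.inl (by rwa [Complex.sub_re, Complex.one_re, sub_pos])

theorem re_one_sub_div_two_lt {z : ℂ} (hz : 1 < z.re) : ((1 - z) / 2).re < 1 / 2 := by
  rw [Complex.div_ofNat_re, Complex.sub_re, Complex.one_re]
  linarith

theorem hasDerivAt_reducedP (ν M : ℂ) {z : ℂ} (hz : 1 < z.re) :
    HasDerivAt (reducedP ν M) (reducedP ν (M + 1) z) z := by
  have hw := re_one_sub_div_two_lt hz
  have hne : z - 1 ≠ 0 := Complex.slitPlane_ne_zero (sub_one_mem_slitPlane hz)
  have hpow : HasDerivAt (fun z : ℂ => (z - 1) ^ (-M)) (-M * (z - 1) ^ (-M - 1) * 1) z :=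
    ((hasDerivAt_id z).sub_const 1).cpow_const (sub_one_mem_slitPlane hz)
  have hpfaff := (((differentiableOn_pfaffHyp (-ν) (ν + 1) (-M + 1)).differentiableAt
    (isOpen_re_lt_half.mem_nhds hw)).hasDerivAt).comp z
      (((hasDerivAt_id z).const_sub 1).div_const 2)
  have hshift := mul_deriv_pfaffHyp_add (-ν) (ν + 1) (-M) hw
  rw [neg_add_eq_sub] at hpfaff hshift
  refine (hpow.mul hpfaff).congr_deriv ?_
  rw [reducedP, sub_add_cancel_right, ← hshift, neg_add', Complex.cpow_sub _ _ hne,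
    Complex.cpow_one]
  simp only [Function.comp, id]
  field_simp
  ring

theorem legendreRecurrence_reducedP (μ ν : ℂ) {z : ℂ} (hz : 1 < z.re) :
    LegendreRecurrence μ ν z (fun n => reducedP ν (μ + n) z) := by
  intro m
  have hne : z - 1 ≠ 0 := Complex.slitPlane_ne_zero (sub_one_mem_slitPlane hz)
  have hcontiguous :=
    pfaffHyp_contiguous (-ν) (ν + 1) (-(μ + m) - 1) (re_one_sub_div_two_lt hz)
  rw [sub_add_cancel, show -(μ + m) - 1 + 2 = 1 - (μ + m) by ring] at hcontiguous
  push_cast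
  simp only [reducedP, legendreConst]
  rw [show 1 - (μ + (m + 1)) = -(μ + m) by ring, show 1 - (μ + (m + 2)) = -(μ + m) - 1 by ring,
    show -(μ + (m + 1)) = -(μ + m) - 1 by ring, show -(μ + (m + 2)) = -(μ + m) - 2 by ring,
    Complex.cpow_sub _ _ hne, Complex.cpow_sub _ _ hne, Complex.cpow_one, Complex.cpow_ofNat]
  field_simp
  linear_combination -2 * (z - 1) * (z - 1) ^ (-(μ + m)) * hcontiguous

theorem isLegendreLadder_reducedP (μ ν : ℂ) :
    IsLegendreLadder μ ν (fun n => reducedP ν (μ + n)) where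
  hasDerivAt n z hz := by
    have hderiv := hasDerivAt_reducedP ν (μ + n) hz
    rwa [add_assoc, ← Nat.cast_add_one] at hderiv
  recurrence _ hz := legendreRecurrence_reducedP μ ν hz

theorem ofReal_sq_cpow_half {s : ℝ} (hs : 0 ≤ s) (M : ℂ) :
    ((s ^ 2 : ℝ) : ℂ) ^ (M / 2) = (s : ℂ) ^ M := by
  have hpow := Complex.cpow_ofNat_mul' (x := (s : ℂ)) (n := 2)
    (by simp [Complex.arg_ofReal_of_nonneg hs, Real.pi_pos])
    (by simp [Complex.arg_ofReal_of_nonneg hs, Real.pi_pos.le]) (M / 2)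
  rw [Complex.ofReal_pow, ← hpow]
  exact congrArg _ (mul_div_cancel₀ M two_ne_zero)

theorem legendreP_prefactor_cosh (M : ℂ) {r : ℝ} (hr : 0 < r) :
    (((Real.cosh r + 1) / (Real.cosh r - 1) : ℝ) : ℂ) ^ (M / 2) =
      (Real.sinh r : ℂ) ^ M * (Real.cosh r - 1 : ℂ) ^ (-M) := by
  have hsinh := Real.sinh_pos_iff.mpr hr
  have hcosh : 0 < Real.cosh r - 1 := sub_pos.mpr (Real.one_lt_cosh.mpr hr.ne')
  have hsq : (Real.cosh r + 1) / (Real.cosh r - 1) = (Real.sinh r * (Real.cosh r - 1)⁻¹) ^ 2 := by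
    field_simp
    rw [Real.sinh_sq]
    ring
  rw [hsq, ofReal_sq_cpow_half (by positivity), Complex.ofReal_mul,
    Complex.mul_cpow_ofReal_nonneg hsinh.le (by positivity), Complex.ofReal_inv,
    Complex.inv_cpow _ _ (Complex.arg_ofReal_of_nonneg hcosh.le ▸ Real.pi_ne_zero.symm),
    Complex.cpow_neg, Complex.ofReal_sub, Complex.ofReal_one]

theorem legendreP_cosh (ν M : ℂ) {r : ℝ} (hr : 0 < r) :
    legendreP ν M (Real.cosh r) = (Real.sinh r : ℂ) ^ M * reducedP ν M (Real.cosh r) := by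
  have hre : (((1 - Real.cosh r) / 2 : ℝ) : ℂ).re < 1 / 2 := by
    rw [Complex.ofReal_re]
    linarith [Real.cosh_pos r]
  rw [legendreP, regHyp_eq_pfaffHyp _ _ _ hre, legendreP_prefactor_cosh M hr, reducedP]
  push_cast
  ring

/-! ### The functions of the second kind -/

/-- The function `z ^ (-a) * ₂F₁(a / 2, (a + 1) / 2; c; z⁻²) / Γ(c)`; up to constants, the functions
of the second kind are of this form with `a = ν + μ + 1` and `c = ν + 3 / 2`. -/
noncomputable def invSqHyp (a c z : ℂ) : ℂ :=
  z ^ (-a) * regHypSeries (a / 2) ((a + 1) / 2) c (z ^ 2)⁻¹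

theorem mul_hypCoeff_half_add_one (a c : ℂ) (n : ℕ) :
    a * hypCoeff ((a + 1) / 2) ((a + 1 + 1) / 2) c n =
      (a + 2 * n) * hypCoeff (a / 2) ((a + 1) / 2) c n := by
  rw [hypCoeff, hypCoeff, show (a + 1 + 1) / 2 = a / 2 + 1 by ring]
  linear_combination 2 * poch ((a + 1) / 2) n * (Gamma (c + n))⁻¹ / (n.factorial : ℂ) *
    mul_poch_add_one (a / 2) n

theorem two_mul_mul_deriv_regHypSeries_half_add (a c : ℂ) {w : ℂ} (hw : ‖w‖ < 1) :
    2 * (w * deriv (regHypSeries (a / 2) ((a + 1) / 2) c) w)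
      + a * regHypSeries (a / 2) ((a + 1) / 2) c w =
    a * regHypSeries ((a + 1) / 2) ((a + 1 + 1) / 2) c w := by
  refine (((hasSum_mul_deriv_regHypSeries _ _ c hw).mul_left 2).add
    ((hasSum_regHypSeries _ _ c hw).mul_left a)).unique
    (((hasSum_regHypSeries _ _ c hw).mul_left a).congr_fun fun n => ?_)
  linear_combination -w ^ n * mul_hypCoeff_half_add_one a c n

theorem regHypSeries_half_contiguous (a c : ℂ) {w : ℂ} (hw : ‖w‖ < 1) :
    a * (a + 1) * (1 - w) * regHypSeries ((a + 1 + 1) / 2) ((a + 1 + 1 + 1) / 2) c w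
      - a * (2 * a - 2 * c + 3) * regHypSeries ((a + 1) / 2) ((a + 1 + 1) / 2) c w
      + a * (a - 2 * c + 2) * regHypSeries (a / 2) ((a + 1) / 2) c w = 0 := by
  have hsum₀ := hasSum_hypCoeff_succ (a / 2) ((a + 1) / 2) c hw
  have hsum₁ := hasSum_hypCoeff_succ ((a + 1) / 2) ((a + 1 + 1) / 2) c hw
  have hsum₂ := (hasSum_hypCoeff_succ ((a + 1 + 1) / 2) ((a + 1 + 1 + 1) / 2) c hw).sub
    ((hasSum_regHypSeries ((a + 1 + 1) / 2) ((a + 1 + 1 + 1) / 2) c hw).mul_left w)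
  have hcoeff₁ := mul_hypCoeff_half_add_one a c
  have hcoeff₂ := mul_hypCoeff_half_add_one (a + 1) c
  have hzero := (((hsum₂.mul_left (a * (a + 1))).sub
    (hsum₁.mul_left (a * (2 * a - 2 * c + 3)))).add
    (hsum₀.mul_left (a * (a - 2 * c + 2)))).unique
    ((hasSum_zero (α := ℂ) (β := ℕ)).congr_fun fun n => by
      have hcoeff₁' := hcoeff₁ (n + 1)
      have hcoeff₂' := hcoeff₂ (n + 1)
      push_cast at hcoeff₁' hcoeff₂'
      linear_combination w ^ (n + 1) * (a * hcoeff₂' - a * hcoeff₂ n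
        + (a + 1 + 2 * (n + 1) - (2 * a - 2 * c + 3)) * hcoeff₁'
        - (a + 1 + 2 * n) * hcoeff₁ n + 4 * hypCoeff_succ (a / 2) ((a + 1) / 2) c n))
  have hcoeff₁₀ := hcoeff₁ 0
  have hcoeff₂₀ := hcoeff₂ 0
  push_cast at hcoeff₁₀ hcoeff₂₀
  linear_combination hzero + a * hcoeff₂₀ + (a + 1 - (2 * a - 2 * c + 3)) * hcoeff₁₀

theorem norm_inv_sq_lt_one {z : ℂ} (hz : 1 < z.re) : ‖(z ^ 2)⁻¹‖ < 1 := by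
  rw [norm_inv, norm_pow]
  exact inv_lt_one_of_one_lt₀ (one_lt_pow₀ (hz.trans_le (Complex.re_le_norm z)) two_ne_zero)

theorem mem_slitPlane_of_one_lt_re {z : ℂ} (hz : 1 < z.re) : z ∈ Complex.slitPlane :=
  Or.inl (one_pos.trans hz)

theorem hasDerivAt_invSqHyp (a c : ℂ) {z : ℂ} (hz : 1 < z.re) :
    HasDerivAt (invSqHyp a c) (-a * invSqHyp (a + 1) c z) z := by
  have hw := norm_inv_sq_lt_one hz
  have hne : z ≠ 0 := Complex.slitPlane_ne_zero (mem_slitPlane_of_one_lt_re hz)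
  have hpow : HasDerivAt (fun z : ℂ => z ^ (-a)) (-a * z ^ (-a - 1) * 1) z :=
    (hasDerivAt_id z).cpow_const (mem_slitPlane_of_one_lt_re hz)
  have hinv : HasDerivAt (fun z : ℂ => (z ^ 2)⁻¹) (-2 * (z ^ 2)⁻¹ * z⁻¹) z := by
    refine ((hasDerivAt_pow 2 z).fun_inv (pow_ne_zero 2 hne)).congr_deriv ?_
    push_cast
    field_simp
  have hseries := (((differentiableOn_regHypSeries (a / 2) ((a + 1) / 2) c).differentiableAt
    (Metric.isOpen_ball.mem_nhds (mem_ball_zero_iff.mpr hw))).hasDerivAt).comp z hinv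
  refine (hpow.mul hseries).congr_deriv ?_
  rw [invSqHyp, neg_add', Complex.cpow_sub _ _ hne, Complex.cpow_one]
  simp only [Function.comp]
  linear_combination -(z ^ (-a) / z) * two_mul_mul_deriv_regHypSeries_half_add a c hw

theorem invSqHyp_contiguous (a c : ℂ) {z : ℂ} (hz : 1 < z.re) :
    a * (a + 1) * (z ^ 2 - 1) * invSqHyp (a + 1 + 1) c z
      - a * (2 * a - 2 * c + 3) * z * invSqHyp (a + 1) c z
      + a * (a - 2 * c + 2) * invSqHyp a c z = 0 := by
  have hne : z ≠ 0 := Complex.slitPlane_ne_zero (mem_slitPlane_of_one_lt_re hz)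
  have hsq : z ^ 2 - 1 = z ^ 2 * (1 - (z ^ 2)⁻¹) := by field_simp
  have hcpow (b : ℂ) : z * z ^ (-(b + 1)) = z ^ (-b) := by
    rw [neg_add', Complex.cpow_sub _ _ hne, Complex.cpow_one, mul_div_cancel₀ _ hne]
  simp only [invSqHyp]
  rw [hsq]
  linear_combination z ^ (-a) * regHypSeries_half_contiguous a c (norm_inv_sq_lt_one hz)
    + a * (a + 1) * (1 - (z ^ 2)⁻¹)
      * regHypSeries ((a + 1 + 1) / 2) ((a + 1 + 1 + 1) / 2) c (z ^ 2)⁻¹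
      * (z * hcpow (a + 1) + hcpow a)
    - a * (2 * a - 2 * c + 3) * regHypSeries ((a + 1) / 2) ((a + 1 + 1) / 2) c (z ^ 2)⁻¹ * hcpow a

/-- The constant factor of the functions of the second kind. -/
noncomputable def legendreQConst (ν M : ℂ) : ℂ :=
  (Real.sqrt Real.pi : ℂ) * Complex.exp (Complex.I * Real.pi * M) * Gamma (ν + M + 1) /
    (2 : ℂ) ^ (ν + 1)

theorem legendreQConst_add_one {ν M : ℂ} (hM : ν + M + 1 ≠ 0) :
    legendreQConst ν (M + 1) = -(ν + M + 1) * legendreQConst ν M := by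
  have hexp : Complex.exp (Complex.I * Real.pi * (M + 1)) =
      -Complex.exp (Complex.I * Real.pi * M) := by
    rw [mul_add_one, Complex.exp_add, mul_comm Complex.I, Complex.exp_pi_mul_I, mul_neg_one]
  rw [legendreQConst, legendreQConst, hexp, ← add_assoc, Complex.Gamma_add_one _ hM]
  ring

/-- The continuation of `(x ^ 2 - 1) ^ (-M / 2) * Q_ν^M (x)` to the half-plane `1 < Re z`. -/
noncomputable def reducedQ (ν M z : ℂ) : ℂ :=
  legendreQConst ν M * invSqHyp (ν + M + 1) (ν + 3 / 2) z

theorem hasDerivAt_reducedQ {ν M : ℂ} (hM : ν + M + 1 ≠ 0) {z : ℂ} (hz : 1 < z.re) :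
    HasDerivAt (reducedQ ν M) (reducedQ ν (M + 1) z) z := by
  refine ((hasDerivAt_invSqHyp (ν + M + 1) (ν + 3 / 2) hz).const_mul _).congr_deriv ?_
  rw [reducedQ, legendreQConst_add_one hM, ← add_assoc]
  ring

theorem legendreRecurrence_reducedQ {μ ν : ℂ} (hν : ∀ n : ℕ, ν + (μ + n) + 1 ≠ 0) {z : ℂ}
    (hz : 1 < z.re) : LegendreRecurrence μ ν z (fun n => reducedQ ν (μ + n) z) := by
  intro m
  have hcontiguous := invSqHyp_contiguous (ν + (μ + m) + 1) (ν + 3 / 2) hz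
  have hconst₁ := legendreQConst_add_one (hν m)
  have hconst₂ := legendreQConst_add_one (hν (m + 1))
  push_cast at hconst₂ ⊢
  simp only [reducedQ, legendreConst]
  rw [show μ + (m + 2) = μ + (m + 1) + 1 by ring, hconst₂, ← add_assoc μ, hconst₁,
    show ν + (μ + m + 1 + 1) + 1 = ν + (μ + m) + 1 + 1 + 1 by ring,
    show ν + (μ + m + 1) + 1 = ν + (μ + m) + 1 + 1 by ring]
  linear_combination legendreQConst ν (μ + m) * hcontiguous

theorem isLegendreLadder_reducedQ {μ ν : ℂ} (hν : ∀ n : ℕ, ν + (μ + n) + 1 ≠ 0) :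
    IsLegendreLadder μ ν (fun n => reducedQ ν (μ + n)) where
  hasDerivAt n z hz := by
    have hderiv := hasDerivAt_reducedQ (hν n) hz
    rwa [add_assoc, ← Nat.cast_add_one] at hderiv
  recurrence _ hz := legendreRecurrence_reducedQ hν hz

theorem legendreQ_cosh (ν M : ℂ) {r : ℝ} (hr : 0 < r) :
    legendreQ ν M (Real.cosh r) = (Real.sinh r : ℂ) ^ M * reducedQ ν M (Real.cosh r) := by
  have hre : 1 < (Real.cosh r : ℂ).re := by
    rw [Complex.ofReal_re]
    exact Real.one_lt_cosh.mpr hr.ne'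
  have harg : ((1 / Real.cosh r ^ 2 : ℝ) : ℂ) = ((Real.cosh r : ℂ) ^ 2)⁻¹ := by
    push_cast
    rw [one_div]
  rw [legendreQ, harg, regHyp, if_pos (norm_inv_sq_lt_one hre), ← Real.sinh_sq,
    ofReal_sq_cpow_half (Real.sinh_pos_iff.mpr hr).le, reducedQ, legendreQConst, invSqHyp,
    add_assoc (ν + M) 1 1, one_add_one_eq_two, Complex.cpow_neg]
  ring

/-! ### Hyperbolic coordinates -/

section HalfAngle

variable {r : ℝ}

theorem one_sub_tanh_sq (r : ℝ) : 1 - Real.tanh r ^ 2 = (Real.cosh r ^ 2)⁻¹ := by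
  have hcosh := (Real.cosh_pos r).ne'
  rw [Real.tanh_eq_sinh_div_cosh]
  field_simp
  exact Real.cosh_sq_sub_sinh_sq r

theorem one_sub_tanh_sq_pos (r : ℝ) : 0 < 1 - Real.tanh r ^ 2 :=
  sub_pos.mpr (Real.tanh_sq_lt_one r)

theorem cosh_eq_tanh_half (r : ℝ) :
    Real.cosh r = (1 + Real.tanh (r / 2) ^ 2) / (1 - Real.tanh (r / 2) ^ 2) := by
  have hcosh := (Real.cosh_pos (r / 2)).ne'
  rw [one_sub_tanh_sq, Real.tanh_eq_sinh_div_cosh]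
  field_simp
  rw [← Real.cosh_two_mul, mul_div_cancel₀ r two_ne_zero]

theorem sinh_eq_tanh_half (r : ℝ) :
    Real.sinh r = 2 * Real.tanh (r / 2) / (1 - Real.tanh (r / 2) ^ 2) := by
  have hcosh := (Real.cosh_pos (r / 2)).ne'
  rw [one_sub_tanh_sq, Real.tanh_eq_sinh_div_cosh]
  field_simp
  rw [← Real.sinh_two_mul, mul_div_cancel₀ r two_ne_zero]

theorem tanh_half_pos (hr : 0 < r) : 0 < Real.tanh (r / 2) := by
  rw [Real.tanh_eq_sinh_div_cosh]
  exact div_pos (Real.sinh_pos_iff.mpr (half_pos hr)) (Real.cosh_pos _)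

theorem tanh_strictMono : StrictMono Real.tanh := fun x y hxy => by
  rwa [← Real.artanh_lt_artanh_iff ⟨Real.neg_one_lt_tanh x, Real.tanh_lt_one x⟩
    ⟨Real.neg_one_lt_tanh y, Real.tanh_lt_one y⟩, Real.artanh_tanh, Real.artanh_tanh]

theorem sinh_mul_tanh_half (r : ℝ) : Real.sinh r * Real.tanh (r / 2) = Real.cosh r - 1 := by
  have hne := (one_sub_tanh_sq_pos (r / 2)).ne'
  rw [sinh_eq_tanh_half, cosh_eq_tanh_half]
  field_simp
  ring

theorem sinh_mul_abs_tanh_half_lt {r' : ℝ} (hr : 0 < r) (hrr' : r < r') :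
    Real.sinh r' * |Real.tanh (r / 2)| < Real.cosh r' - 1 := by
  rw [abs_of_pos (tanh_half_pos hr), ← sinh_mul_tanh_half]
  exact mul_lt_mul_of_pos_left (tanh_strictMono (by linarith))
    (Real.sinh_pos_iff.mpr (hr.trans hrr'))

theorem coshRho_tanh_half (r r' t : ℝ) :
    coshRho (Real.cosh r') (Real.sinh r') t (Real.tanh (r / 2)) =
      ((Real.cosh r * Real.cosh r' - Real.sinh r * Real.sinh r' * t : ℝ) : ℂ) := by
  have hne : (1 - (Real.tanh (r / 2) : ℂ) ^ 2) ≠ 0 := mod_cast (one_sub_tanh_sq_pos (r / 2)).ne'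
  rw [coshRho, cosh_eq_tanh_half r, sinh_eq_tanh_half r]
  push_cast [-Complex.ofReal_tanh]
  field_simp
  ring

theorem one_lt_cosh_mul_cosh_sub {r' : ℝ} (hr : 0 < r) (hrr' : r < r') (γ : ℝ) :
    1 < Real.cosh r * Real.cosh r' - Real.sinh r * Real.sinh r' * Real.cos γ := by
  have hre := one_lt_coshRho (Real.sinh_sq r') (Real.sinh_pos_iff.mpr (hr.trans hrr'))
    (Real.abs_cos_le_one γ) (sinh_mul_abs_tanh_half_lt hr hrr')
  rwa [coshRho_tanh_half, Complex.ofReal_re] at hre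

theorem sinh_cpow_mul_one_sub_tanh_half_sq_cpow (μ : ℂ) (hr : 0 < r) :
    (Real.sinh r : ℂ) ^ μ * (1 - (Real.tanh (r / 2) : ℂ) ^ 2) ^ μ =
      2 ^ μ * (Real.tanh (r / 2) : ℂ) ^ μ := by
  have hpos := one_sub_tanh_sq_pos (r / 2)
  have hdouble : Real.sinh r * (1 - Real.tanh (r / 2) ^ 2) = 2 * Real.tanh (r / 2) := by
    rw [sinh_eq_tanh_half, div_mul_cancel₀ _ hpos.ne']
  have hcpow := Complex.mul_cpow_ofReal_nonneg (Real.sinh_pos_iff.mpr hr).le hpos.le μ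
  rw [← Complex.ofReal_mul, hdouble, Complex.ofReal_mul,
    Complex.mul_cpow_ofReal_nonneg zero_le_two (tanh_half_pos hr).le] at hcpow
  exact_mod_cast hcpow.symm

theorem legendreP_neg_cosh (ν M : ℂ) (hr : 0 < r) :
    legendreP ν (-M) (Real.cosh r) =
      (Real.tanh (r / 2) : ℂ) ^ M * (1 - (Real.tanh (r / 2) : ℂ) ^ 2) ^ (-ν) *
        regHypSeries (M - ν) (-ν) (1 + M) ((Real.tanh (r / 2) : ℂ) ^ 2) := by
  have hcosh := cosh_eq_tanh_half r
  have hu := tanh_half_pos hr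
  have hu₁ := one_sub_tanh_sq_pos (r / 2)
  set u := Real.tanh (r / 2)
  have hprefactor : (Real.cosh r + 1) / (Real.cosh r - 1) = u⁻¹ ^ 2 := by
    rw [hcosh, div_add_one hu₁.ne', div_sub_one hu₁.ne']
    field_simp
    ring
  have hargument : (((1 - Real.cosh r) / 2 : ℝ) : ℂ) = -((u : ℂ) ^ 2 / (1 - (u : ℂ) ^ 2)) := by
    rw [show (1 - Real.cosh r) / 2 = -(u ^ 2 / (1 - u ^ 2)) by rw [hcosh]; field_simp; ring]
    push_cast
    rfl
  have hre : (((1 - Real.cosh r) / 2 : ℝ) : ℂ).re < 1 / 2 := by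
    rw [Complex.ofReal_re]
    linarith [Real.cosh_pos r]
  have hnorm : ‖(u : ℂ) ^ 2‖ < 1 := by
    rw [norm_pow, Complex.norm_real, Real.norm_eq_abs, sq_abs]
    exact sub_pos.mp hu₁
  rw [legendreP, regHyp_eq_pfaffHyp _ _ _ hre, hargument, pfaffHyp_neg_div_one_sub _ _ _ hnorm,
    hprefactor, ofReal_sq_cpow_half (inv_pos.mpr hu).le, Complex.ofReal_inv,
    Complex.inv_cpow _ _ (Complex.arg_ofReal_of_nonneg hu.le ▸ Real.pi_ne_zero.symm),
    Complex.cpow_neg, inv_inv, regHypSeries_symm (M - ν), sub_neg_eq_add,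
    add_comm ν, add_sub_add_left_eq_sub, mul_assoc]

end HalfAngle

section AdditionTheorem

variable {μ ν : ℂ} {r r' : ℝ}

theorem Gamma_ne_zero_of_add_natCast_ne_zero (hμ : ∀ n : ℕ, μ + n ≠ 0) : Gamma μ ≠ 0 :=
  Complex.Gamma_ne_zero fun m h => hμ m (by linear_combination h)

theorem Gamma_one_add_add_natCast (hμ : ∀ n : ℕ, μ + n ≠ 0) (n : ℕ) :
    Gamma (1 + μ + n) = (n + μ) * poch μ n * Gamma μ := by
  have hGamma : Gamma (μ + n) ≠ 0 := Complex.Gamma_ne_zero fun m h =>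
    hμ (n + m) (by push_cast; linear_combination h)
  have hGamma₀ : Gamma μ ≠ 0 := Gamma_ne_zero_of_add_natCast_ne_zero hμ
  have hshift := poch_mul_inv_Gamma μ n
  rw [show 1 + μ + n = μ + n + 1 by ring, Complex.Gamma_add_one _ (hμ n)]
  field_simp at hshift
  linear_combination -(μ + n) * hshift

theorem ofReal_cpow_ne_zero {x : ℝ} (hx : 0 < x) (M : ℂ) : (x : ℂ) ^ M ≠ 0 :=
  fun h => hx.ne' (mod_cast ((Complex.cpow_eq_zero_iff _ _).mp h).1)

theorem summand_eq_mul_additionTerm (hμ : ∀ n : ℕ, μ + n ≠ 0) (hr : 0 < r) (hr' : 0 < r')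
    (φ : ℕ → ℂ) (t : ℂ) (n : ℕ) :
    (-1 : ℂ) ^ n * (n + μ) * legendreP ν (-(μ + n)) (Real.cosh r) *
        ((Real.sinh r' : ℂ) ^ (μ + n) * φ n) * gegenbauerC n μ t =
      (Real.sinh r : ℂ) ^ μ * (Real.sinh r' : ℂ) ^ μ / (2 ^ μ * Gamma μ) *
        (1 - (Real.tanh (r / 2) : ℂ) ^ 2) ^ (μ - ν) *
        additionTerm μ ν (Real.sinh r') φ t n (Real.tanh (r / 2)) := by
  have hu : (Real.tanh (r / 2) : ℂ) ≠ 0 := Complex.ofReal_ne_zero.mpr (tanh_half_pos hr).ne'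
  have hu₁ : (1 - (Real.tanh (r / 2) : ℂ) ^ 2) ≠ 0 := mod_cast (one_sub_tanh_sq_pos (r / 2)).ne'
  have hs : (Real.sinh r' : ℂ) ≠ 0 := Complex.ofReal_ne_zero.mpr (Real.sinh_pos_iff.mpr hr').ne'
  have htwo : (2 : ℂ) ^ μ ≠ 0 := ofReal_cpow_ne_zero two_pos μ
  have hGamma : Gamma μ ≠ 0 := Gamma_ne_zero_of_add_natCast_ne_zero hμ
  have hpoch := poch_ne_zero hμ n
  have hsplit := sinh_cpow_mul_one_sub_tanh_half_sq_cpow μ hr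
  rw [legendreP_neg_cosh ν (μ + n) hr, additionTerm, additionCoeff,
    Gamma_one_add_add_natCast hμ, Complex.cpow_add _ _ hu, Complex.cpow_add _ _ hs,
    Complex.cpow_natCast, Complex.cpow_natCast, sub_eq_add_neg μ ν, Complex.cpow_add _ _ hu₁,
    ← add_assoc, neg_pow (Real.sinh r' : ℂ), mul_pow,
    (eq_div_iff htwo).mpr ((mul_comm _ _).trans hsplit.symm)]
  field_simp

theorem IsLegendreLadder.summable_additionTerm_tanh_half {F : ℕ → ℂ → ℂ}
    (hF : IsLegendreLadder μ ν F) (hμ : ∀ n : ℕ, μ + n ≠ 0) (hμ' : ∀ n : ℕ, μ + 1 / 2 + n ≠ 0)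
    (γ : ℝ) (hr : 0 < r) (hrr' : r < r') :
    Summable fun n => additionTerm μ ν (Real.sinh r') (fun n => F n (Real.cosh r'))
      (Real.cos γ) n (Real.tanh (r / 2)) := by
  have hr' := hr.trans hrr'
  refine (summable_norm_additionTerm hμ hμ' ν (sub_pos.mpr (Real.one_lt_cosh.mpr hr'.ne'))
    (fun D hD hDR => hF.exists_norm_le hD (by rwa [Complex.ofReal_re])) γ ?_ ?_).of_norm
  · simpa only [Complex.norm_real, Real.norm_eq_abs] using Real.abs_tanh_lt_one (r / 2)
  · simpa only [Complex.norm_real, Real.norm_eq_abs,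
      abs_of_pos (Real.sinh_pos_iff.mpr hr')] using sinh_mul_abs_tanh_half_lt hr hrr'

theorem IsLegendreLadder.addition_theorem {F : ℕ → ℂ → ℂ} {L : ℕ → ℝ → ℂ}
    (hF : IsLegendreLadder μ ν F) (hμ : ∀ n : ℕ, μ + n ≠ 0) (hμ' : ∀ n : ℕ, μ + 1 / 2 + n ≠ 0)
    (hL : ∀ n : ℕ, ∀ r : ℝ, 0 < r →
      L n (Real.cosh r) = (Real.sinh r : ℂ) ^ (μ + n) * F n (Real.cosh r))
    {γ ρ : ℝ} (hr : 0 < r) (hrr' : r < r') (hρ : 0 ≤ ρ)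
    (hcosh : Real.cosh ρ =
      Real.cosh r * Real.cosh r' - Real.sinh r * Real.sinh r' * Real.cos γ) :
    Summable (fun n : ℕ => (-1 : ℂ) ^ n * (n + μ) * legendreP ν (-(μ + n)) (Real.cosh r) *
        L n (Real.cosh r') * gegenbauerC n μ (Real.cos γ)) ∧
      1 / (Real.sinh ρ : ℂ) ^ μ * L 0 (Real.cosh ρ) =
        (2 : ℂ) ^ μ * Gamma μ / ((Real.sinh r * Real.sinh r' : ℝ) : ℂ) ^ μ *
          ∑' n : ℕ, (-1 : ℂ) ^ n * (n + μ) * legendreP ν (-(μ + n)) (Real.cosh r) *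
            L n (Real.cosh r') * gegenbauerC n μ (Real.cos γ) := by
  have hr' : 0 < r' := hr.trans hrr'
  have hs := Real.sinh_pos_iff.mpr hr
  have hs' := Real.sinh_pos_iff.mpr hr'
  have hρ₀ : 0 < ρ := hρ.lt_of_ne fun h => by
    have hgt := one_lt_cosh_mul_cosh_sub hr hrr' γ
    rw [← hcosh, ← h, Real.cosh_zero] at hgt
    exact hgt.false
  have happly :=
    hF.apply_coshRho hμ hμ' (Real.sinh_sq r') hs' γ (sinh_mul_abs_tanh_half_lt hr hrr')
  rw [coshRho_tanh_half, ← hcosh] at happly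
  simp only [hL _ r' hr', summand_eq_mul_additionTerm hμ hr hr' fun n => F n (Real.cosh r')]
  refine ⟨(hF.summable_additionTerm_tanh_half hμ hμ' γ hr hrr').mul_left _, ?_⟩
  have htwo : (2 : ℂ) ^ μ ≠ 0 := ofReal_cpow_ne_zero two_pos μ
  have hGamma : Gamma μ ≠ 0 := Gamma_ne_zero_of_add_natCast_ne_zero hμ
  have hsμ := ofReal_cpow_ne_zero hs μ
  have hsμ' := ofReal_cpow_ne_zero hs' μ
  have hρμ := ofReal_cpow_ne_zero (Real.sinh_pos_iff.mpr hρ₀) μ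
  rw [tsum_mul_left, hL 0 ρ hρ₀, Nat.cast_zero, add_zero, happly, Complex.ofReal_mul,
    Complex.mul_cpow_ofReal_nonneg hs.le hs'.le]
  field_simp

end AdditionTheorem

theorem two_mul_add_natCast_ne_zero {μ : ℂ} (hμ : -(1 / 2 : ℝ) < μ.re) (hμ0 : μ ≠ 0) (k : ℕ) :
    2 * μ + k ≠ 0 := by
  rcases k.eq_zero_or_pos with rfl | hk
  · simpa using hμ0
  · intro h
    have hre : 2 * μ.re + k = 0 := by simpa using congrArg Complex.re h
    have hone : (1 : ℝ) ≤ k := Nat.one_le_cast.mpr hk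
    linarith

theorem mainTheorem2_general (μ ν : ℂ) (hμ : ∀ k : ℕ, 2 * μ + k ≠ 0)
    (r r' γ ρ : ℝ) (hr : 0 < r) (hr' : 0 < r') (hrr' : r ≠ r') (hρ : 0 ≤ ρ)
    (hcosh : Real.cosh ρ =
      Real.cosh r * Real.cosh r' - Real.sinh r * Real.sinh r' * Real.cos γ) :
    (Summable (fun n : ℕ => (-1 : ℂ) ^ n * (n + μ) *
          legendreP ν (-(μ + n)) (Real.cosh (min r r')) *
          legendreP ν (μ + n) (Real.cosh (max r r')) * gegenbauerC n μ (Real.cos γ)) ∧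
      1 / (Real.sinh ρ : ℂ) ^ μ * legendreP ν μ (Real.cosh ρ) =
        (2 : ℂ) ^ μ * Complex.Gamma μ / ((Real.sinh r * Real.sinh r' : ℝ) : ℂ) ^ μ *
          ∑' n : ℕ, (-1 : ℂ) ^ n * (n + μ) *
            legendreP ν (-(μ + n)) (Real.cosh (min r r')) *
            legendreP ν (μ + n) (Real.cosh (max r r')) * gegenbauerC n μ (Real.cos γ)) ∧
    ((∀ k : ℕ, 1 ≤ k → ν + μ ≠ -(k : ℂ)) →
      Summable (fun n : ℕ => (-1 : ℂ) ^ n * (n + μ) *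
          legendreP ν (-(μ + n)) (Real.cosh (min r r')) *
          legendreQ ν (μ + n) (Real.cosh (max r r')) * gegenbauerC n μ (Real.cos γ)) ∧
      1 / (Real.sinh ρ : ℂ) ^ μ * legendreQ ν μ (Real.cosh ρ) =
        (2 : ℂ) ^ μ * Complex.Gamma μ / ((Real.sinh r * Real.sinh r' : ℝ) : ℂ) ^ μ *
          ∑' n : ℕ, (-1 : ℂ) ^ n * (n + μ) *
            legendreP ν (-(μ + n)) (Real.cosh (min r r')) *
            legendreQ ν (μ + n) (Real.cosh (max r r')) * gegenbauerC n μ (Real.cos γ)) := by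
  wlog h : r < r' generalizing r r'
  · have hswap := this r' r hr' hr hrr'.symm (by rw [hcosh]; ring)
      (hrr'.symm.lt_of_le (not_lt.mp h))
    rwa [min_comm, max_comm, mul_comm (Real.sinh r')] at hswap
  rw [min_eq_left h.le, max_eq_right h.le]
  have hint (n : ℕ) : μ + n ≠ 0 := fun h₀ =>
    hμ (2 * n) (by push_cast; linear_combination 2 * h₀)
  have hhalf (n : ℕ) : μ + 1 / 2 + n ≠ 0 := fun h₀ =>
    hμ (2 * n + 1) (by push_cast; linear_combination 2 * h₀)
  refine ⟨?_, fun hνμ => ?_⟩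
  · simpa only [Nat.cast_zero, add_zero] using (isLegendreLadder_reducedP μ ν).addition_theorem
      hint hhalf (fun n _ => legendreP_cosh ν (μ + n)) hr h hρ hcosh
  · have hladder := isLegendreLadder_reducedQ (μ := μ) (ν := ν) fun n h₀ =>
      hνμ (n + 1) n.succ_pos (by push_cast; linear_combination h₀)
    simpa only [Nat.cast_zero, add_zero] using hladder.addition_theorem
      hint hhalf (fun n _ => legendreQ_cosh ν (μ + n)) hr h hρ hcosh

theorem mainTheorem2 (μ ν : ℂ) (hμ : -(1 / 2 : ℝ) < μ.re) (hμ0 : μ ≠ 0)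
    (hν : ∀ k : ℕ, 1 ≤ k → ν ≠ -(k : ℂ))
    (r r' γ ρ : ℝ) (hr : 0 < r) (hr' : 0 < r') (hrr' : r ≠ r') (hρ : 0 ≤ ρ)
    (hcosh : Real.cosh ρ =
      Real.cosh r * Real.cosh r' - Real.sinh r * Real.sinh r' * Real.cos γ) :
    (Summable (fun n : ℕ => (-1 : ℂ) ^ n * (n + μ) *
          legendreP ν (-(μ + n)) (Real.cosh (min r r')) *
          legendreP ν (μ + n) (Real.cosh (max r r')) * gegenbauerC n μ (Real.cos γ)) ∧
      1 / (Real.sinh ρ : ℂ) ^ μ * legendreP ν μ (Real.cosh ρ) =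
        (2 : ℂ) ^ μ * Complex.Gamma μ / ((Real.sinh r * Real.sinh r' : ℝ) : ℂ) ^ μ *
          ∑' n : ℕ, (-1 : ℂ) ^ n * (n + μ) *
            legendreP ν (-(μ + n)) (Real.cosh (min r r')) *
            legendreP ν (μ + n) (Real.cosh (max r r')) * gegenbauerC n μ (Real.cos γ)) ∧
    ((∀ k : ℕ, 1 ≤ k → ν + μ ≠ -(k : ℂ)) →
      Summable (fun n : ℕ => (-1 : ℂ) ^ n * (n + μ) *
          legendreP ν (-(μ + n)) (Real.cosh (min r r')) *
          legendreQ ν (μ + n) (Real.cosh (max r r')) * gegenbauerC n μ (Real.cos γ)) ∧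
      1 / (Real.sinh ρ : ℂ) ^ μ * legendreQ ν μ (Real.cosh ρ) =
        (2 : ℂ) ^ μ * Complex.Gamma μ / ((Real.sinh r * Real.sinh r' : ℝ) : ℂ) ^ μ *
          ∑' n : ℕ, (-1 : ℂ) ^ n * (n + μ) *
            legendreP ν (-(μ + n)) (Real.cosh (min r r')) *
            legendreQ ν (μ + n) (Real.cosh (max r r')) * gegenbauerC n μ (Real.cos γ)) :=
  mainTheorem2_general μ ν (two_mul_add_natCast_ne_zero hμ hμ0) r r' γ ρ hr hr' hrr' hρ hcosh
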